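/- Let $M$ be a closed smooth manifold of dimension $n$ with a fixed positive smooth density $\lambda$. Identify a density $a$ on $M$ with its Radon–Nikodym derivative $a/\lambda$, so that $\operatorname{Dens}_+(M)$ is the set of positive functions in the Fréchet space $C^\infty(M)$ and, for real $k>n/2$, $\operatorname{Dens}^k_+(M)$ is the set of (continuous) positive functions in $H^k(M)$. Let $\alpha\in(-1,1)$, $p=\frac{2}{1-\alpha}$, $p^*=\frac{2}{1+\alpha}$, and let $\nabla^{(\alpha)}$ be the connection on $\operatorname{Dens}_+(M)$ induced by the $\alpha$-divergence $$D^{(\alpha)}(\mu\|\nu)=p\int_M\nu+p^*\int_M\mu-p^*p\int_M\left(\tfrac{\mu}{\lambda}\right)^{1/p}\left(\tfrac{\nu}{\lambda}\right)^{1/p^*}\lambda$$ through $$\int_M \frac{\nabla^{(\alpha)}_a b}{\mu}\,\frac{c}{\mu}\,\mu=-\partial_\mu\bigl(\partial_\mu\partial_\nu D^{(\alpha)}(\mu\|\nu)[b,c]\bigr)[a]\Big|_{\nu=\mu}\qquad\text{for all } c\in T_\mu\operatorname{Dens}_+(M).$$ 1. A twice differentiable path $\mu:J\to\operatorname{Dens}_+(M)$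 on an interval $J$ with more than one point (for instance $J=[0,1]$) is a geodesic of $\nabla^{(\alpha)}$, that is $\nabla^{(\alpha)}_{\mu_t}\mu_t=0$, if and only if $$\mu_{tt}=\frac{1}{p^*}\frac{\mu_t}{\mu}\mu_t .\qquad(\ast)$$ 2. For every real $k>n/2$ equation $(\ast)$ is locally well-posed on $\operatorname{Dens}^k_+(M)$: for all $\mu_0\in\operatorname{Dens}^k_+(M)$ and $v_0\in H^k(M)$ there is a unique solution $\mu$ in $\operatorname{Dens}^k_+(M)$ (twice differentiable in time in the $H^k$ topology) with $\mu(0)=\mu_0$, $\mu_t(0)=v_0$, defined on a maximal interval of existence $[0,T)$, $0<T\le\infty$. That is, every solution on some $[0,T')$ with the same initial data satisfies $T'\le T$ and agrees with $\mu$ on $[0,T')$. 3. The maximal existence time $T$ (and the maximal solution) is the same for all $k>n/2$ for which the initial data are as in 2. For $\mu_0\in\operatorname{Dens}_+(M)$ and $v_0\in C^\infty(M)$, existence, uniqueness and maximality also hold for solutions in $\operatorname{Dens}_+(M)$ (twice differentiable in time in the $C^\infty$ topology), with the same $T$. -/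

import Mathlib

open Set Filter Topology MeasureTheory
open scoped Manifold ContDiff ENNReal FourierTransform

universe u

noncomputable section

namespace AlphaGeodesic

/-! Throughout, `M` is a manifold modelled on `EuclideanSpace ℝ (Fin n)`, a positive smooth density
`lam` on `M` is fixed, and a density `a` on `M` is represented by its Radon-Nikodym derivative
`a / lam : M → ℝ`. For two densities the quotient `a / μ` is then the pointwise quotient of the
representing functions, and the integral of `a` is the integral of its representing function
against `lam`. -/

/-- `lam` is a positive smooth density (volume): in every chart of the smooth structure it has a
positive smooth density with respect to Lebesgue measure. -/
def IsSmoothVolume (n : ℕ) {M : Type u} [TopologicalSpace M]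
    [ChartedSpace (EuclideanSpace ℝ (Fin n)) M] [MeasurableSpace M] (lam : Measure M) : Prop :=
  ∀ e ∈ IsManifold.maximalAtlas (𝓡 n) ∞ M, ∃ ρ : EuclideanSpace ℝ (Fin n) → ℝ,
    ContDiffOn ℝ ∞ ρ e.target ∧ (∀ y ∈ e.target, 0 < ρ y) ∧
    (lam.restrict e.source).map e =
      (volume.restrict e.target).withDensity (fun y => ENNReal.ofReal (ρ y))

/-! ### Localization in charts -/

/-- A smooth chart of `M` with a smooth cut-off function that is compactly supported in the
image of the chart. -/
structure ChartCutoff (n : ℕ) (M : Type u) [TopologicalSpace M]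
    [ChartedSpace (EuclideanSpace ℝ (Fin n)) M] where
  chart : OpenPartialHomeomorph M (EuclideanSpace ℝ (Fin n))
  chart_mem : chart ∈ IsManifold.maximalAtlas (𝓡 n) ∞ M
  cutoff : EuclideanSpace ℝ (Fin n) → ℝ
  cutoff_smooth : ContDiff ℝ ∞ cutoff
  cutoff_compact : HasCompactSupport cutoff
  cutoff_support : tsupport cutoff ⊆ chart.target

/-- The function `f` in the chart, multiplied by the cut-off and extended by zero to `ℝⁿ`. -/
def localize {n : ℕ} {M : Type u} [TopologicalSpace M]
    [ChartedSpace (EuclideanSpace ℝ (Fin n)) M] (c : ChartCutoff n M) (f : M → ℝ) :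
    EuclideanSpace ℝ (Fin n) → ℝ :=
  fun y => c.cutoff y * f (c.chart.symm y)

/-- The `H^k(ℝⁿ)` norm `(∫ (1 + |ξ|²)^k |ĝ(ξ)|² dξ)^(1/2)`, of real order `k`, of a continuous
compactly supported function `g`. -/
def sobolevNorm {n : ℕ} (k : ℝ) (g : EuclideanSpace ℝ (Fin n) → ℝ) : ℝ≥0∞ :=
  eLpNorm (fun ξ : EuclideanSpace ℝ (Fin n) =>
    ((1 + ‖ξ‖ ^ 2) ^ (k / 2) : ℝ) • 𝓕 (fun y => (g y : ℂ)) ξ) 2 volume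

/-! ### The function spaces `H^k(M)` and `C^∞(M)` -/

/-- A space of real functions on `M`, with a family of seminorms giving its topology. Only the
two instances `sobolevSpace` and `smoothSpace` below are used. -/
structure FunctionSpace (M : Type u) where
  Mem : (M → ℝ) → Prop
  Index : Type u
  seminorm : Index → (M → ℝ) → ℝ≥0∞

/-- The Sobolev space `H^k(M)` for `k > n / 2`, each class being represented by its continuous
representative: the functions all of whose localizations in charts are in `H^k(ℝⁿ)`. -/
def sobolevSpace (n : ℕ) (M : Type u) [TopologicalSpace M]
    [ChartedSpace (EuclideanSpace ℝ (Fin n)) M] (k : ℝ) : FunctionSpace M where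
  Mem f := Continuous f ∧ ∀ c : ChartCutoff n M, sobolevNorm k (localize c f) < ⊤
  Index := ChartCutoff n M
  seminorm c f := sobolevNorm k (localize c f)

/-- The Fréchet space `C^∞(M)`: locally uniform convergence of all derivatives in charts. -/
def smoothSpace (n : ℕ) (M : Type u) [TopologicalSpace M]
    [ChartedSpace (EuclideanSpace ℝ (Fin n)) M] : FunctionSpace M where
  Mem f := ContMDiff (𝓡 n) 𝓘(ℝ, ℝ) ∞ f
  Index := ChartCutoff n M × ℕ
  seminorm i f := ⨆ y, ‖iteratedFDeriv ℝ i.2 (localize i.1 f) y‖ₑ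

/-- The positive elements of the space: `Dens^k_+(M)` for `sobolevSpace n M k` and `Dens_+(M)` for
`smoothSpace n M`. Tangent vectors are arbitrary elements of the space. -/
def FunctionSpace.IsDensity {M : Type u} (X : FunctionSpace M) (μ : M → ℝ) : Prop :=
  X.Mem μ ∧ ∀ x, 0 < μ x

/-- The curve `γ` has derivative `w` at time `t` relative to the time set `J`, in the topology of
the space `X`: the difference quotients converge to `w` in every seminorm. -/
def FunctionSpace.HasTimeDeriv {M : Type u} (X : FunctionSpace M) (γ : ℝ → M → ℝ) (w : M → ℝ)
    (J : Set ℝ) (t : ℝ) : Prop :=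
  ∀ i : X.Index, Tendsto
    (fun s => X.seminorm i (fun x => (s - t)⁻¹ * (γ s x - γ t x) - w x)) (𝓝[J \ {t}] t) (𝓝 0)

/-- `γ` is a twice differentiable curve of positive elements of `X` on the time set `J`, with
velocity `v` and acceleration `a`. -/
def FunctionSpace.IsDensityPath {M : Type u} (X : FunctionSpace M) (J : Set ℝ)
    (γ v a : ℝ → M → ℝ) : Prop :=
  ∀ t ∈ J, X.IsDensity (γ t) ∧ X.Mem (v t) ∧ X.Mem (a t) ∧
    X.HasTimeDeriv γ (v t) J t ∧ X.HasTimeDeriv v (a t) J t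

/-! ### The connection induced by the `α`-divergence -/

/-- The exponent `p = 2 / (1 - α)`. -/
def pExp (α : ℝ) : ℝ := 2 / (1 - α)

/-- The Hölder conjugate `p* = 2 / (1 + α)` of `p`. -/
def pStar (α : ℝ) : ℝ := 2 / (1 + α)

/-- The Fisher-Rao metric `G_μ(a, b) = ∫ (a / μ) (b / μ) μ`. -/
def fisherRao {M : Type u} [MeasurableSpace M] (lam : Measure M) (μ a b : M → ℝ) : ℝ :=
  ∫ x, (a x / μ x) * (b x / μ x) * μ x ∂lam

/-- The `α`-divergence `D(μ || ν)`. -/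
def divergence {M : Type u} [MeasurableSpace M] (lam : Measure M) (α : ℝ) (μ ν : M → ℝ) : ℝ :=
  pExp α * (∫ x, ν x ∂lam) + pStar α * (∫ x, μ x ∂lam)
    - pStar α * pExp α * ∫ x, (μ x) ^ (1 / pExp α) * (ν x) ^ (1 / pStar α) ∂lam

/-- The mixed second derivative `∂_μ ∂_ν D(μ || ν)[b, c]` of the `α`-divergence, in direction `b`
in the first and in direction `c` in the second argument. -/
def mixedDeriv {M : Type u} [MeasurableSpace M] (lam : Measure M) (α : ℝ)
    (μ ν b c : M → ℝ) : ℝ :=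
  deriv (fun s : ℝ => deriv (fun r : ℝ =>
    divergence lam α (fun x => μ x + s * b x) (fun x => ν x + r * c x)) 0) 0

/-- `w` is the covariant derivative at time `t`, with respect to the `α`-connection, of the field
`b` of tangent vectors along the curve `γ` in `Dens_+(M)`: with `μ = γ t`,
`G_μ(w, c) = - ∂_μ (∂_μ ∂_ν D(μ || ν)[b, c])[γ_t] |_{ν = μ}` for all tangent vectors `c`.
If `b` comes from a vector field on `Dens_+(M)`, this says that `w` is the covariant derivative of
that vector field in the direction of the velocity of `γ`. -/
def IsAlphaCovDeriv (n : ℕ) {M : Type u} [TopologicalSpace M]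
    [ChartedSpace (EuclideanSpace ℝ (Fin n)) M] [MeasurableSpace M] (lam : Measure M) (α : ℝ)
    (J : Set ℝ) (γ b : ℝ → M → ℝ) (t : ℝ) (w : M → ℝ) : Prop :=
  ∀ c : M → ℝ, (smoothSpace n M).Mem c →
    HasDerivWithinAt (fun s => - mixedDeriv lam α (γ s) (γ t) (b s) c)
      (fisherRao lam (γ t) w c) J t

/-- The path `γ` in `Dens_+(M)`, with velocity `v`, is a geodesic of the `α`-connection on the
time set `J`: the covariant derivative of its velocity along it vanishes. -/
def IsAlphaGeodesic (n : ℕ) {M : Type u} [TopologicalSpace M]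
    [ChartedSpace (EuclideanSpace ℝ (Fin n)) M] [MeasurableSpace M] (lam : Measure M) (α : ℝ)
    (J : Set ℝ) (γ v : ℝ → M → ℝ) : Prop :=
  ∀ t ∈ J, IsAlphaCovDeriv n lam α J γ v t (fun _ => 0)

/-! ### Solutions of the geodesic equation -/

/-- The time interval `[0, T)`, where `T` may be infinite. -/
def timeInterval (T : ℝ≥0∞) : Set ℝ := {t | 0 ≤ t ∧ ENNReal.ofReal t < T}

/-- The acceleration `(1 / p*) (v / μ) v` prescribed by the geodesic equation. -/
def geodesicAcc {M : Type u} (α : ℝ) (μ v : M → ℝ) : M → ℝ :=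
  fun x => 1 / pStar α * (v x / μ x) * v x

/-- `γ` solves the geodesic equation on `[0, T)` among the positive elements of `X`, with initial
density `μ₀` and initial velocity `v₀`. -/
def FunctionSpace.IsSolution {M : Type u} (X : FunctionSpace M) (α : ℝ) (μ₀ v₀ : M → ℝ)
    (T : ℝ≥0∞) (γ : ℝ → M → ℝ) : Prop :=
  ∃ v : ℝ → M → ℝ, γ 0 = μ₀ ∧ v 0 = v₀ ∧
    X.IsDensityPath (timeInterval T) γ v (fun t => geodesicAcc α (γ t) (v t))

/-- `γ` is the unique solution, and `[0, T)` is its maximal interval of existence: every solution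
with the same initial data lives on a smaller interval and agrees with `γ` there. -/
def FunctionSpace.IsMaximalSolution {M : Type u} (X : FunctionSpace M) (α : ℝ) (μ₀ v₀ : M → ℝ)
    (T : ℝ≥0∞) (γ : ℝ → M → ℝ) : Prop :=
  X.IsSolution α μ₀ v₀ T γ ∧
    ∀ (T' : ℝ≥0∞) (γ' : ℝ → M → ℝ), X.IsSolution α μ₀ v₀ T' γ' →
      T' ≤ T ∧ ∀ t ∈ timeInterval T', γ' t = γ t

end AlphaGeodesic

end

/-! Both halves come from explicit formulas.

Geodesic equation. Differentiating under the integral gives the mixed derivative `-∫ ν^(1/p* - 1) c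
μ^(1/p - 1) b` (`mixedDeriv_eq`). With `ν = γ t` frozen, the derivative along the path is, since
`1/p + 1/p* = 1`, the integral of `c (a - (1/p*) v²/γ) / γ` (`hasDerivWithinAt_neg_mixedDeriv`). If
it vanishes for every smooth `c`, take `c` to be the bracket itself: a nonnegative continuous
function has integral zero, hence is zero because `lam` charges every nonempty open set.

Well-posedness. The equation has no spatial derivatives, and it says that `μ^(1/p)` is affine in
time at each point of `M`. The only candidate is therefore `μ₀ (1 + t q)^p` with `q = v₀ / (p μ₀)`
(`geodesicFlow`), and a positive solution cannot outlive the positivity of `1 + t q`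
(`scalar_geodesic_eq`). On a compact `M` this fixes a time `T > 0` that does not depend on the
function space. It remains to see that the candidate is a solution in each space. For this it is
enough that the space is an algebra, is closed under real powers of positive elements, controls
point values, and has an `o(h)` remainder for `(1 + h ρ)^s - 1 - s h ρ`: this is
`FunctionSpace.IsAdmissible`.

The analytic work is admissibility of `H^k(M)` for real `k > n/2`. Fourier transforms of `H^k`
functions are in `L¹`, and `sobolevNorm_mul_le` bounds a product by terms with one factor in the
Wiener norm `‖ĝ‖_{L¹}` and the other in the Sobolev norm. For powers, a Wiener function is locally
close to a constant in Wiener norm (`exists_cutoff_wienerNorm_le`), so `g = c (1 + ρ)` locally with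
`ρ` small in that norm. The `H^k` norm of `ρ` need not be small, but in `mixedNorm` it is weighted
by `ε`; for small `ε` multiplication by `ρ` has norm at most `1/2`, and the binomial series of `(1 +
ρ)^s` is under control. The same series gives the remainder estimate. For `C^∞(M)` the remainder is
reduced to Sobolev spaces of large order, which dominate sup norms of derivatives. -/

noncomputable section

namespace AlphaGeodesic

/-! ### Fourier estimates on `ℝⁿ`: Wiener norm, Sobolev norm, products -/

section Fourier

variable {n : ℕ}

/-- The Fourier transform of a real function. -/
def realFourier (g : EuclideanSpace ℝ (Fin n) → ℝ) : EuclideanSpace ℝ (Fin n) → ℂ :=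
  𝓕 (fun y => (g y : ℂ))

/-- The norm of the Wiener algebra: the `L¹` norm of the Fourier transform. -/
def wienerNorm (g : EuclideanSpace ℝ (Fin n) → ℝ) : ℝ≥0∞ :=
  ∫⁻ ξ, ‖realFourier g ξ‖ₑ

/-- The weight `(1 + |ξ|²)^(k/2)`. -/
def weight (k : ℝ) (ξ : EuclideanSpace ℝ (Fin n)) : ℝ≥0∞ :=
  ENNReal.ofReal ((1 + ‖ξ‖ ^ 2) ^ (k / 2))

lemma measurable_weight (k : ℝ) : Measurable (weight (n := n) k) := by
  unfold weight; fun_prop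

lemma integrable_ofReal {g : EuclideanSpace ℝ (Fin n) → ℝ} (hg : Continuous g)
    (hs : HasCompactSupport g) : Integrable (fun y => (g y : ℂ)) :=
  (hg.integrable_of_hasCompactSupport hs).ofReal

lemma continuous_realFourier {g : EuclideanSpace ℝ (Fin n) → ℝ} (hg : Continuous g)
    (hs : HasCompactSupport g) : Continuous (realFourier g) :=
  VectorFourier.fourierIntegral_continuous Real.continuous_fourierChar
    (by simpa using (continuous_inner : Continuous fun p :
      EuclideanSpace ℝ (Fin n) × EuclideanSpace ℝ (Fin n) => inner ℝ p.1 p.2))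
    (integrable_ofReal hg hs)

lemma sobolevNorm_eq (k : ℝ) (g : EuclideanSpace ℝ (Fin n) → ℝ) :
    sobolevNorm k g = eLpNorm (fun ξ => weight k ξ * ‖realFourier g ξ‖ₑ) 2 volume := by
  unfold sobolevNorm
  refine eLpNorm_congr_enorm_ae (Eventually.of_forall fun ξ => ?_)
  simp only [enorm_smul, enorm_eq_self, weight]
  rw [Real.enorm_of_nonneg (by positivity)]
  rfl

lemma realFourier_add {f g : EuclideanSpace ℝ (Fin n) → ℝ} (hf : Continuous f)
    (hfs : HasCompactSupport f) (hg : Continuous g) (hgs : HasCompactSupport g)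
    (ξ : EuclideanSpace ℝ (Fin n)) :
    realFourier (fun y => f y + g y) ξ = realFourier f ξ + realFourier g ξ := by
  unfold realFourier
  simp only [Real.fourier_eq, Complex.ofReal_add, smul_add]
  exact integral_add ((Real.fourierIntegral_convergent_iff ξ).2 (integrable_ofReal hf hfs))
    ((Real.fourierIntegral_convergent_iff ξ).2 (integrable_ofReal hg hgs))

lemma realFourier_const_mul (c : ℝ) (f : EuclideanSpace ℝ (Fin n) → ℝ)
    (ξ : EuclideanSpace ℝ (Fin n)) :
    realFourier (fun y => c * f y) ξ = c * realFourier f ξ := by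
  unfold realFourier
  simp only [Real.fourier_eq, Complex.ofReal_mul]
  rw [← integral_const_mul]
  congr 1 with y
  simp only [Circle.smul_def, smul_eq_mul]
  ring

lemma wienerNorm_const_mul (c : ℝ) (f : EuclideanSpace ℝ (Fin n) → ℝ) :
    wienerNorm (fun y => c * f y) = ‖c‖ₑ * wienerNorm f := by
  unfold wienerNorm
  simp only [realFourier_const_mul, enorm_mul]
  rw [lintegral_const_mul' _ _ (by simp)]
  congr 1
  rw [enorm_eq_iff_norm_eq, Complex.norm_real]

lemma sobolevNorm_const_mul (k c : ℝ) (f : EuclideanSpace ℝ (Fin n) → ℝ) :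
    sobolevNorm k (fun y => c * f y) = ‖c‖ₑ * sobolevNorm k f := by
  have h : (fun ξ : EuclideanSpace ℝ (Fin n) => ((1 + ‖ξ‖ ^ 2) ^ (k / 2) : ℝ) •
      𝓕 (fun y => ((c * f y : ℝ) : ℂ)) ξ) = c • (fun ξ : EuclideanSpace ℝ (Fin n) =>
      ((1 + ‖ξ‖ ^ 2) ^ (k / 2) : ℝ) • 𝓕 (fun y => (f y : ℂ)) ξ) := by
    ext ξ
    have := realFourier_const_mul c f ξ
    unfold realFourier at this
    rw [this, Pi.smul_apply]
    simp only [Complex.real_smul]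
    ring
  unfold sobolevNorm
  rw [h, eLpNorm_const_smul]

lemma aemeasurable_weight_mul (k : ℝ) {g : EuclideanSpace ℝ (Fin n) → ℝ} (hg : Continuous g)
    (hs : HasCompactSupport g) : AEMeasurable (fun ξ => weight k ξ * ‖realFourier g ξ‖ₑ) volume :=
  ((measurable_weight k).mul (continuous_realFourier hg hs).enorm.measurable).aemeasurable

lemma wienerNorm_add_le {f g : EuclideanSpace ℝ (Fin n) → ℝ} (hf : Continuous f)
    (hfs : HasCompactSupport f) (hg : Continuous g) (hgs : HasCompactSupport g) :
    wienerNorm (fun y => f y + g y) ≤ wienerNorm f + wienerNorm g := by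
  unfold wienerNorm
  rw [← lintegral_add_left (continuous_realFourier hf hfs).enorm.measurable]
  refine lintegral_mono fun ξ => ?_
  rw [realFourier_add hf hfs hg hgs]
  exact enorm_add_le _ _

lemma sobolevNorm_add_le (k : ℝ) {f g : EuclideanSpace ℝ (Fin n) → ℝ} (hf : Continuous f)
    (hfs : HasCompactSupport f) (hg : Continuous g) (hgs : HasCompactSupport g) :
    sobolevNorm k (fun y => f y + g y) ≤ sobolevNorm k f + sobolevNorm k g := by
  simp only [sobolevNorm_eq]
  refine le_trans (eLpNorm_mono_enorm fun ξ => ?_) (eLpNorm_add_le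
    (aemeasurable_weight_mul k hf hfs).aestronglyMeasurable
    (aemeasurable_weight_mul k hg hgs).aestronglyMeasurable (by norm_num))
  simp only [enorm_eq_self, Pi.add_apply, ← mul_add]
  rw [realFourier_add hf hfs hg hgs]
  gcongr
  exact enorm_add_le _ _

/-- Cauchy-Schwarz: weighted `L¹` norms of the Fourier transform are controlled by Sobolev norms
of large order. -/
lemma exists_lintegral_weight_le_sobolevNorm (j k : ℝ) (hk : (n : ℝ) / 2 + j < k) :
    ∃ C : ℝ≥0∞, C ≠ ⊤ ∧ ∀ g : EuclideanSpace ℝ (Fin n) → ℝ, Continuous g → HasCompactSupport g →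
      ∫⁻ ξ, weight j ξ * ‖realFourier g ξ‖ₑ ≤ C * sobolevNorm k g := by
  -- The square of this weight is `(1 + |ξ|²)^(-(k - j))`, integrable because `2 (k - j) > n`.
  have hfin : eLpNorm (weight (n := n) (j - k)) 2 volume < ⊤ := by
    rw [eLpNorm_lt_top_iff_lintegral_rpow_enorm_lt_top (by norm_num) (by norm_num)]
    have hint : Integrable (fun x : EuclideanSpace ℝ (Fin n) =>
        ((1 + ‖x‖ ^ 2) ^ (-(2 * (k - j)) / 2) : ℝ)) :=
      integrable_rpow_neg_one_add_norm_sq (by rw [finrank_euclideanSpace_fin]; linarith)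
    refine lt_of_eq_of_lt ?_ hint.lintegral_lt_top
    refine lintegral_congr fun x => ?_
    simp only [weight, enorm_eq_self]
    rw [ENNReal.ofReal_rpow_of_nonneg (by positivity) (by norm_num),
      ← Real.rpow_mul (by positivity)]
    congr 2
    simp
    ring
  refine ⟨_, hfin.ne, fun g hg hs => ?_⟩
  rw [sobolevNorm_eq]
  have h1 := ENNReal.lintegral_mul_le_Lp_mul_Lq (volume : Measure (EuclideanSpace ℝ (Fin n)))
    (p := 2) (q := 2) (by constructor <;> norm_num) (measurable_weight (j - k)).aemeasurable
    (aemeasurable_weight_mul k hg hs)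
  rw [eLpNorm_eq_lintegral_rpow_enorm_toReal (by norm_num) (by norm_num),
    eLpNorm_eq_lintegral_rpow_enorm_toReal (by norm_num) (by norm_num)]
  simp only [enorm_eq_self, ENNReal.toReal_ofNat]
  refine le_trans (le_of_eq ?_) h1
  refine lintegral_congr fun ξ => ?_
  simp only [Pi.mul_apply, ← mul_assoc]
  congr 1
  unfold weight
  rw [← ENNReal.ofReal_mul (by positivity), ← Real.rpow_add (by positivity)]
  congr 2
  ring

lemma weight_zero (ξ : EuclideanSpace ℝ (Fin n)) : weight 0 ξ = 1 := by simp [weight]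

lemma exists_wienerNorm_le_sobolevNorm (k : ℝ) (hk : (n : ℝ) / 2 < k) :
    ∃ C : ℝ≥0∞, C ≠ ⊤ ∧ ∀ g : EuclideanSpace ℝ (Fin n) → ℝ, Continuous g → HasCompactSupport g →
      wienerNorm g ≤ C * sobolevNorm k g := by
  simpa [weight_zero, wienerNorm] using exists_lintegral_weight_le_sobolevNorm (n := n) 0 k (by simpa using hk)

lemma integrable_realFourier {g : EuclideanSpace ℝ (Fin n) → ℝ} (hg : Continuous g)
    (hs : HasCompactSupport g) (hw : wienerNorm g ≠ ⊤) : Integrable (realFourier g) :=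
  ⟨(continuous_realFourier hg hs).aestronglyMeasurable, hw.lt_top⟩

lemma fourierInv_realFourier {g : EuclideanSpace ℝ (Fin n) → ℝ} (hg : Continuous g)
    (hs : HasCompactSupport g) (hw : wienerNorm g ≠ ⊤) (x : EuclideanSpace ℝ (Fin n)) :
    𝓕⁻ (realFourier g) x = g x :=
  congrFun (Continuous.fourierInv_fourier_eq (f := fun y => (g y : ℂ)) (by fun_prop)
    (integrable_ofReal hg hs) (integrable_realFourier hg hs hw)) x

/-- Fourier inversion writes `g x` as an integral of the Fourier transform against unimodular
factors. If the Wiener norm is infinite there is nothing to prove. -/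
lemma enorm_le_wienerNorm {g : EuclideanSpace ℝ (Fin n) → ℝ} (hg : Continuous g)
    (hs : HasCompactSupport g) (x : EuclideanSpace ℝ (Fin n)) : ‖g x‖ₑ ≤ wienerNorm g := by
  by_cases hw : wienerNorm g = ⊤
  · simp [hw]
  have h := fourierInv_realFourier hg hs hw x
  have hc : ‖g x‖ₑ = ‖(g x : ℂ)‖ₑ := by rw [enorm_eq_iff_norm_eq, Complex.norm_real]
  rw [hc, ← h, Real.fourierInv_eq]
  refine (enorm_integral_le_lintegral_enorm _).trans (le_of_eq ?_)
  refine lintegral_congr fun ξ => ?_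
  rw [enorm_eq_iff_norm_eq, Circle.norm_smul]

/-- The Fourier transform of a product is the convolution of the Fourier transforms. -/
lemma realFourier_mul {f g : EuclideanSpace ℝ (Fin n) → ℝ} (hf : Continuous f)
    (hfs : HasCompactSupport f) (hg : Continuous g) (hgs : HasCompactSupport g)
    (hw : wienerNorm f ≠ ⊤) (ξ : EuclideanSpace ℝ (Fin n)) :
    realFourier (fun y => f y * g y) ξ = ∫ η, realFourier f η * realFourier g (ξ - η) := by
  -- Fubini applies because `g` and the Fourier transform of `f` are both integrable; inserting the
  -- inversion formula for `f` then gives the convolution.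
  have hint : Integrable (Function.uncurry fun (x η : EuclideanSpace ℝ (Fin n)) =>
      (Real.fourierChar (-inner ℝ x (ξ - η)) • (g x : ℂ)) * realFourier f η)
      (volume.prod volume) := by
    have h1 := (integrable_ofReal hg hgs).mul_prod (integrable_realFourier hf hfs hw)
    refine h1.congr' ?_ ?_
    · have := continuous_realFourier hf hfs
      refine Continuous.aestronglyMeasurable ?_
      simp only [Function.uncurry_def, Circle.smul_def]
      have h3 : Continuous fun z : EuclideanSpace ℝ (Fin n) × EuclideanSpace ℝ (Fin n) =>
          ((Real.fourierChar (-inner ℝ z.1 (ξ - z.2)) : Circle) : ℂ) :=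
        continuous_subtype_val.comp (Real.continuous_fourierChar.comp (by fun_prop))
      have h4 : Continuous fun z : EuclideanSpace ℝ (Fin n) × EuclideanSpace ℝ (Fin n) =>
          (g z.1 : ℂ) := by fun_prop
      exact (h3.mul h4).mul (this.comp continuous_snd)
    · refine Eventually.of_forall fun z => ?_
      simp only [Function.uncurry_def, norm_mul, Circle.norm_smul]
  have h2 := integral_integral_swap hint
  calc realFourier (fun y => f y * g y) ξ
      = ∫ x, ∫ η, (Real.fourierChar (-inner ℝ x (ξ - η)) • (g x : ℂ)) * realFourier f η := by
        unfold realFourier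
        rw [Real.fourier_eq]
        congr 1 with x
        have h := fourierInv_realFourier hf hfs hw x
        rw [Complex.ofReal_mul, ← h, Real.fourierInv_eq]
        simp only [Circle.smul_def, smul_eq_mul, realFourier]
        rw [← mul_assoc, ← integral_const_mul, ← integral_mul_const]
        congr 1 with η
        have he : -inner ℝ x (ξ - η) = -inner ℝ x ξ + inner ℝ η x := by
          rw [inner_sub_right, real_inner_comm x η]; ring
        rw [he, AddChar.map_add_eq_mul, Circle.coe_mul]
        ring
    _ = ∫ η, realFourier f η * realFourier g (ξ - η) := by
        rw [h2]
        congr 1 with η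
        rw [integral_mul_const, mul_comm]
        rfl

/-- Young's inequality for the convolution of an `L¹` and an `L²` function. -/
lemma eLpNorm_two_conv_le {a b : EuclideanSpace ℝ (Fin n) → ℝ≥0∞} (ha : Measurable a)
    (hb : Measurable b) :
    eLpNorm (fun ξ => ∫⁻ η, a η * b (ξ - η)) 2 volume ≤ (∫⁻ η, a η) * eLpNorm b 2 volume := by
  -- Cauchy-Schwarz for the splitting `a b = a^(1/2) · (a^(1/2) b)`. Integrating in `ξ` with Tonelli
  -- then produces `(∫ a)² ∫ b²`.
  have key : ∀ ξ, (∫⁻ η, a η * b (ξ - η)) ^ (2 : ℝ) ≤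
      (∫⁻ η, a η) * ∫⁻ η, a η * b (ξ - η) ^ (2 : ℝ) := by
    intro ξ
    have hbm : Measurable fun η => b (ξ - η) := hb.comp (by fun_prop)
    have h1 := ENNReal.lintegral_mul_le_Lp_mul_Lq
      (volume : Measure (EuclideanSpace ℝ (Fin n))) (p := 2) (q := 2)
      (by constructor <;> norm_num) (f := fun η => a η ^ (1 / 2 : ℝ))
      (g := fun η => a η ^ (1 / 2 : ℝ) * b (ξ - η)) (by fun_prop) (by fun_prop)
    have e1 : ∀ η, a η ^ (1 / 2 : ℝ) * a η ^ (1 / 2 : ℝ) = a η := fun η => by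
      rw [← ENNReal.rpow_add_of_nonneg _ _ (by norm_num) (by norm_num)]; norm_num
    have e2 : ∀ x : ℝ≥0∞, (x ^ (1 / 2 : ℝ)) ^ (2 : ℝ) = x := fun x => by
      rw [← ENNReal.rpow_mul]; norm_num
    simp only [Pi.mul_apply, ← mul_assoc, e1, e2, ENNReal.mul_rpow_of_nonneg _ _ zero_le_two] at h1
    have h3 := ENNReal.rpow_le_rpow h1 zero_le_two
    rwa [ENNReal.mul_rpow_of_nonneg _ _ zero_le_two, e2, e2] at h3
  have e0 : ∀ x : ℝ≥0∞, (x ^ (2 : ℝ)) ^ (1 / 2 : ℝ) = x := fun x => by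
    rw [← ENNReal.rpow_mul]; norm_num
  rw [eLpNorm_eq_lintegral_rpow_enorm_toReal (by norm_num) (by norm_num),
    eLpNorm_eq_lintegral_rpow_enorm_toReal (by norm_num) (by norm_num)]
  simp only [enorm_eq_self, ENNReal.toReal_ofNat]
  rw [← e0 (∫⁻ η, a η), ← ENNReal.mul_rpow_of_nonneg _ _ (by norm_num)]
  refine ENNReal.rpow_le_rpow ?_ (by norm_num)
  calc ∫⁻ ξ, (∫⁻ η, a η * b (ξ - η)) ^ (2 : ℝ)
      ≤ ∫⁻ ξ, (∫⁻ η, a η) * ∫⁻ η, a η * b (ξ - η) ^ (2 : ℝ) := lintegral_mono key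
    _ = (∫⁻ η, a η) * ∫⁻ ξ, ∫⁻ η, a η * b (ξ - η) ^ (2 : ℝ) := by
        rw [lintegral_const_mul]
        exact Measurable.lintegral_prod_right'
          (f := fun z : EuclideanSpace ℝ (Fin n) × EuclideanSpace ℝ (Fin n) =>
            a z.2 * b (z.1 - z.2) ^ (2 : ℝ)) (by fun_prop)
    _ = (∫⁻ η, a η) * ∫⁻ η, ∫⁻ ξ, a η * b (ξ - η) ^ (2 : ℝ) := by
        rw [lintegral_lintegral_swap]
        exact Measurable.aemeasurable (by fun_prop)
    _ = (∫⁻ η, a η) * ∫⁻ η, a η * ∫⁻ ξ, b ξ ^ (2 : ℝ) := by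
        congr 2 with η
        rw [lintegral_const_mul _ (by fun_prop),
          lintegral_sub_right_eq_self (fun x => b x ^ (2 : ℝ)) η]
    _ = (∫⁻ η, a η) ^ (2 : ℝ) * ∫⁻ ξ, b ξ ^ (2 : ℝ) := by
        rw [lintegral_mul_const _ ha, ← mul_assoc]
        congr 1
        rw [← pow_two]; norm_cast

lemma enorm_realFourier_mul_le {f g : EuclideanSpace ℝ (Fin n) → ℝ} (hf : Continuous f)
    (hfs : HasCompactSupport f) (hg : Continuous g) (hgs : HasCompactSupport g)
    (hw : wienerNorm f ≠ ⊤) (ξ : EuclideanSpace ℝ (Fin n)) :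
    ‖realFourier (fun y => f y * g y) ξ‖ₑ ≤
      ∫⁻ η, ‖realFourier f η‖ₑ * ‖realFourier g (ξ - η)‖ₑ := by
  rw [realFourier_mul hf hfs hg hgs hw]
  refine (enorm_integral_le_lintegral_enorm _).trans (le_of_eq ?_)
  simp

lemma wienerNorm_mul_le {f g : EuclideanSpace ℝ (Fin n) → ℝ} (hf : Continuous f)
    (hfs : HasCompactSupport f) (hg : Continuous g) (hgs : HasCompactSupport g)
    (hw : wienerNorm f ≠ ⊤) :
    wienerNorm (fun y => f y * g y) ≤ wienerNorm f * wienerNorm g := by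
  have mf := (continuous_realFourier hf hfs).enorm.measurable
  have mg := (continuous_realFourier hg hgs).enorm.measurable
  calc wienerNorm (fun y => f y * g y)
      ≤ ∫⁻ ξ, ∫⁻ η, ‖realFourier f η‖ₑ * ‖realFourier g (ξ - η)‖ₑ :=
        lintegral_mono (enorm_realFourier_mul_le hf hfs hg hgs hw)
    _ = ∫⁻ η, ∫⁻ ξ, ‖realFourier f η‖ₑ * ‖realFourier g (ξ - η)‖ₑ := by
        rw [lintegral_lintegral_swap]
        exact Measurable.aemeasurable ((mf.comp measurable_snd).mul (mg.comp (by fun_prop)))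
    _ = wienerNorm f * wienerNorm g := by
        simp only [wienerNorm]
        rw [← lintegral_mul_const _ mf]
        congr 1 with η
        have mg' : Measurable fun ξ => ‖realFourier g (ξ - η)‖ₑ := mg.comp (by fun_prop)
        rw [lintegral_const_mul _ mg',
          lintegral_sub_right_eq_self (fun x => ‖realFourier g x‖ₑ) η]

/-- One of `η`, `ξ - η` is at least half as large as `ξ` in the sense of `√(1 + |·|²)`. This is what
distributes the weight over the two factors of a convolution. -/
lemma weight_le (k : ℝ) (hk : 0 ≤ k) (ξ η : EuclideanSpace ℝ (Fin n)) :
    weight k ξ ≤ ENNReal.ofReal (2 ^ k) * (weight k η + weight k (ξ - η)) := by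
  have hpos : ∀ x : EuclideanSpace ℝ (Fin n), 0 < (1 + ‖x‖ ^ 2) := fun x => by positivity
  have hw : ∀ x : EuclideanSpace ℝ (Fin n), (1 + ‖x‖ ^ 2) ^ (k / 2) = √(1 + ‖x‖ ^ 2) ^ k :=
    fun x => by
      rw [Real.sqrt_eq_rpow, ← Real.rpow_mul (hpos x).le]
      congr 1
      ring
  unfold weight
  rw [← ENNReal.ofReal_add (by positivity) (by positivity), ← ENNReal.ofReal_mul (by positivity)]
  refine ENNReal.ofReal_le_ofReal ?_
  simp only [hw]
  set a := √(1 + ‖η‖ ^ 2)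
  set b := √(1 + ‖ξ - η‖ ^ 2)
  have ha : 0 ≤ a := Real.sqrt_nonneg _
  have hb : 0 ≤ b := Real.sqrt_nonneg _
  have hab : √(1 + ‖ξ‖ ^ 2) ≤ 2 * max a b := by
    rw [Real.sqrt_le_left (by positivity)]
    have h1 : ‖ξ‖ ≤ ‖η‖ + ‖ξ - η‖ := by
      simpa using norm_add_le η (ξ - η)
    have h2 : a ^ 2 = 1 + ‖η‖ ^ 2 := Real.sq_sqrt (hpos _).le
    have h3 : b ^ 2 = 1 + ‖ξ - η‖ ^ 2 := Real.sq_sqrt (hpos _).le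
    have h4 : a ^ 2 ≤ max a b ^ 2 := by gcongr; exact le_max_left _ _
    have h5 : b ^ 2 ≤ max a b ^ 2 := by gcongr; exact le_max_right _ _
    nlinarith [norm_nonneg ξ, norm_nonneg η, norm_nonneg (ξ - η), sq_nonneg (‖η‖ - ‖ξ - η‖)]
  calc √(1 + ‖ξ‖ ^ 2) ^ k ≤ (2 * max a b) ^ k :=
        Real.rpow_le_rpow (Real.sqrt_nonneg _) hab hk
    _ = 2 ^ k * (max a b) ^ k := Real.mul_rpow (by norm_num) (le_max_of_le_left ha)
    _ ≤ 2 ^ k * (a ^ k + b ^ k) := by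
        gcongr
        rcases max_cases a b with h | h <;> rw [h.1] <;>
          linarith [Real.rpow_nonneg ha k, Real.rpow_nonneg hb k]

/-- The algebra property of Sobolev spaces: each term is linear in the Sobolev norm of one factor and
in the Wiener norm of the other. -/
lemma sobolevNorm_mul_le {k : ℝ} (hk : 0 ≤ k) {f g : EuclideanSpace ℝ (Fin n) → ℝ}
    (hf : Continuous f) (hfs : HasCompactSupport f) (hg : Continuous g)
    (hgs : HasCompactSupport g) (hwf : wienerNorm f ≠ ⊤) :
    sobolevNorm k (fun y => f y * g y) ≤
      ENNReal.ofReal (2 ^ k) * (wienerNorm f * sobolevNorm k g + wienerNorm g * sobolevNorm k f) := by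
  have mf := (continuous_realFourier hf hfs).enorm.measurable
  have mg := (continuous_realFourier hg hgs).enorm.measurable
  have mk := measurable_weight (n := n) k
  simp only [sobolevNorm_eq]
  set C := ENNReal.ofReal (2 ^ k)
  set A : EuclideanSpace ℝ (Fin n) → ℝ≥0∞ := fun ξ =>
    ∫⁻ η, ‖realFourier f η‖ₑ * (weight k (ξ - η) * ‖realFourier g (ξ - η)‖ₑ) with hA
  set B : EuclideanSpace ℝ (Fin n) → ℝ≥0∞ := fun ξ =>
    ∫⁻ η, ‖realFourier g η‖ₑ * (weight k (ξ - η) * ‖realFourier f (ξ - η)‖ₑ) with hB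
  have mA : Measurable A := Measurable.lintegral_prod_right'
    (f := fun z : EuclideanSpace ℝ (Fin n) × EuclideanSpace ℝ (Fin n) =>
      ‖realFourier f z.2‖ₑ * (weight k (z.1 - z.2) * ‖realFourier g (z.1 - z.2)‖ₑ))
      ((mf.comp measurable_snd).mul ((mk.comp (by fun_prop)).mul (mg.comp (by fun_prop))))
  have mB : Measurable B := Measurable.lintegral_prod_right'
    (f := fun z : EuclideanSpace ℝ (Fin n) × EuclideanSpace ℝ (Fin n) =>
      ‖realFourier g z.2‖ₑ * (weight k (z.1 - z.2) * ‖realFourier f (z.1 - z.2)‖ₑ))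
      ((mg.comp measurable_snd).mul ((mk.comp (by fun_prop)).mul (mf.comp (by fun_prop))))
  -- `B` is written in the form to which Young's inequality applies; the substitution `η ↦ ξ - η`
  -- turns it into the term of the convolution whose weight falls on `f`.
  have hB' : ∀ ξ, B ξ = ∫⁻ η, weight k η * ‖realFourier f η‖ₑ * ‖realFourier g (ξ - η)‖ₑ := by
    intro ξ
    rw [hB]
    rw [← lintegral_sub_left_eq_self _ ξ]
    refine lintegral_congr fun η => ?_
    simp only [sub_sub_cancel]
    ring
  have pt : ∀ ξ, weight k ξ * ‖realFourier (fun y => f y * g y) ξ‖ₑ ≤ C * (A ξ + B ξ) := by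
    intro ξ
    rw [hB', hA]
    have mg' : Measurable fun η => ‖realFourier g (ξ - η)‖ₑ := mg.comp (by fun_prop)
    have mk' : Measurable fun η => weight k (ξ - η) := mk.comp (by fun_prop)
    simp only
    rw [← lintegral_add_left (by fun_prop), ← lintegral_const_mul _ (by fun_prop)]
    refine (mul_le_mul_right (enorm_realFourier_mul_le hf hfs hg hgs hwf ξ) _).trans ?_
    rw [← lintegral_const_mul _ (by fun_prop)]
    refine lintegral_mono fun η => ?_
    refine (mul_le_mul_left (weight_le k hk ξ η) _).trans (le_of_eq ?_)
    ring
  calc eLpNorm (fun ξ => weight k ξ * ‖realFourier (fun y => f y * g y) ξ‖ₑ) 2 volume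
      ≤ C * eLpNorm (fun ξ => A ξ + B ξ) 2 volume := by
        have hC : C = ((2 ^ k : ℝ).toNNReal : ℝ≥0∞) := rfl
        rw [hC]
        refine eLpNorm_le_mul_eLpNorm_of_ae_le_mul'' (ε := ℝ≥0∞) (ε' := ℝ≥0∞) _
          (mA.add mB).aestronglyMeasurable ?_
        exact Eventually.of_forall fun ξ => by
          rw [enorm_eq_self, enorm_eq_self]; exact pt ξ
    _ ≤ C * (eLpNorm A 2 volume + eLpNorm B 2 volume) := by
        gcongr
        exact eLpNorm_add_le mA.aestronglyMeasurable mB.aestronglyMeasurable (by norm_num)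
    _ ≤ _ := mul_le_mul_right (add_le_add (eLpNorm_two_conv_le mf (mk.mul mg))
        (eLpNorm_two_conv_le mg (mk.mul mf))) _

/-- Smooth compactly supported functions have finite Sobolev norms. -/
lemma sobolevNorm_lt_top_of_contDiff (k : ℝ) {g : EuclideanSpace ℝ (Fin n) → ℝ}
    (hg : ContDiff ℝ ∞ g) (hs : HasCompactSupport g) : sobolevNorm k g < ⊤ := by
  have hs' : HasCompactSupport (fun y => (g y : ℂ)) := hs.comp_left Complex.ofReal_zero
  have hg' : ContDiff ℝ ∞ (fun y => (g y : ℂ)) := Complex.ofRealCLM.contDiff.comp hg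
  set φ := hs'.toSchwartzMap hg'
  have h1 : (fun ξ : EuclideanSpace ℝ (Fin n) => ((1 + ‖ξ‖ ^ 2) ^ (k / 2) : ℝ) •
      𝓕 (fun y => (g y : ℂ)) ξ) = SchwartzMap.smulLeftCLM ℂ
        (fun ξ : EuclideanSpace ℝ (Fin n) => ((1 + ‖ξ‖ ^ 2) ^ (k / 2) : ℝ)) (𝓕 φ) := by
    ext ξ
    rw [SchwartzMap.smulLeftCLM_apply_apply (by fun_prop), SchwartzMap.fourier_coe]
    rfl
  unfold sobolevNorm
  rw [h1]
  exact (SchwartzMap.memLp _ 2 volume).2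

end Fourier

/-! ### Power series, binomial remainders and derivatives of Sobolev functions -/

section SobolevFunctions

variable {n : ℕ}

/-- Continuous compactly supported functions in `H^k(ℝⁿ)`. -/
structure IsSobolev (k : ℝ) (g : EuclideanSpace ℝ (Fin n) → ℝ) : Prop where
  continuous : Continuous g
  hasCompactSupport : HasCompactSupport g
  sobolevNorm_lt_top : sobolevNorm k g < ⊤

namespace IsSobolev

variable {k : ℝ} {f g : EuclideanSpace ℝ (Fin n) → ℝ}

lemma wienerNorm_lt_top (hk : (n : ℝ) / 2 < k) (hg : IsSobolev k g) : wienerNorm g < ⊤ := by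
  obtain ⟨C, hC, h⟩ := exists_wienerNorm_le_sobolevNorm (n := n) k hk
  exact (h g hg.1 hg.2).trans_lt (ENNReal.mul_lt_top hC.lt_top hg.3)

lemma add (hf : IsSobolev k f) (hg : IsSobolev k g) : IsSobolev k fun y => f y + g y :=
  ⟨hf.1.add hg.1, hf.2.add hg.2,
    (sobolevNorm_add_le k hf.1 hf.2 hg.1 hg.2).trans_lt (ENNReal.add_lt_top.2 ⟨hf.3, hg.3⟩)⟩

lemma const_mul (c : ℝ) (hf : IsSobolev k f) : IsSobolev k fun y => c * f y :=
  ⟨continuous_const.mul hf.1, hf.2.mul_left, by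
    rw [sobolevNorm_const_mul]
    exact ENNReal.mul_lt_top enorm_lt_top hf.3⟩

lemma mul (hk : (n : ℝ) / 2 < k) (hf : IsSobolev k f) (hg : IsSobolev k g) :
    IsSobolev k fun y => f y * g y := by
  have hk0 : 0 ≤ k := le_trans (by positivity) hk.le
  have wf := hf.wienerNorm_lt_top hk
  have wg := hg.wienerNorm_lt_top hk
  refine ⟨hf.1.mul hg.1, hf.2.mul_right, ?_⟩
  refine (sobolevNorm_mul_le hk0 hf.1 hf.2 hg.1 hg.2 wf.ne).trans_lt ?_
  exact ENNReal.mul_lt_top ENNReal.ofReal_lt_top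
    (ENNReal.add_lt_top.2 ⟨ENNReal.mul_lt_top wf hg.3, ENNReal.mul_lt_top wg hf.3⟩)

lemma of_contDiff (k : ℝ) (hg : ContDiff ℝ ∞ g) (hs : HasCompactSupport g) : IsSobolev k g :=
  ⟨hg.continuous, hs, sobolevNorm_lt_top_of_contDiff k hg hs⟩

end IsSobolev

/-- A weighted sum of the Wiener norm and of the Sobolev norm. -/
def mixedNorm (k : ℝ) (ε : ℝ≥0∞) (g : EuclideanSpace ℝ (Fin n) → ℝ) : ℝ≥0∞ :=
  wienerNorm g + ε * sobolevNorm k g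

variable {k : ℝ} {f g W ρ : EuclideanSpace ℝ (Fin n) → ℝ} {ε : ℝ≥0∞}

lemma mixedNorm_lt_top (hk : (n : ℝ) / 2 < k) (hε : ε ≠ ⊤) (hg : IsSobolev k g) :
    mixedNorm k ε g < ⊤ :=
  ENNReal.add_lt_top.2 ⟨hg.wienerNorm_lt_top hk, ENNReal.mul_lt_top hε.lt_top hg.3⟩

lemma mixedNorm_const_mul (c : ℝ) (f : EuclideanSpace ℝ (Fin n) → ℝ) :
    mixedNorm k ε (fun y => c * f y) = ‖c‖ₑ * mixedNorm k ε f := by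
  unfold mixedNorm
  rw [wienerNorm_const_mul, sobolevNorm_const_mul]
  ring

lemma mixedNorm_add_le (hf : IsSobolev k f) (hg : IsSobolev k g) :
    mixedNorm k ε (fun y => f y + g y) ≤ mixedNorm k ε f + mixedNorm k ε g := by
  unfold mixedNorm
  calc _ ≤ wienerNorm f + wienerNorm g + ε * (sobolevNorm k f + sobolevNorm k g) :=
        add_le_add (wienerNorm_add_le hf.1 hf.2 hg.1 hg.2)
          (mul_le_mul_right (sobolevNorm_add_le k hf.1 hf.2 hg.1 hg.2) _)
    _ = _ := by ring

/-- Multiplication by `ρ` is bounded; the Sobolev norm of `ρ` enters with the small factor `ε`. -/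
lemma mixedNorm_mul_le (hk : (n : ℝ) / 2 < k) (hf : IsSobolev k f) (hρ : IsSobolev k ρ) :
    mixedNorm k ε (fun y => f y * ρ y) ≤
      ((1 + ENNReal.ofReal (2 ^ k)) * wienerNorm ρ +
        ε * ENNReal.ofReal (2 ^ k) * sobolevNorm k ρ) * mixedNorm k ε f := by
  have hk0 : 0 ≤ k := le_trans (by positivity) hk.le
  have wf := (hf.wienerNorm_lt_top hk).ne
  unfold mixedNorm
  set C := ENNReal.ofReal (2 ^ k)
  calc _ ≤ wienerNorm f * wienerNorm ρ +
        ε * (C * (wienerNorm f * sobolevNorm k ρ + wienerNorm ρ * sobolevNorm k f)) :=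
        add_le_add (wienerNorm_mul_le hf.1 hf.2 hρ.1 hρ.2 wf)
          (mul_le_mul_right (sobolevNorm_mul_le hk0 hf.1 hf.2 hρ.1 hρ.2 wf) _)
    -- The added nonnegative terms complete the sum to a product with the factor `mixedNorm k ε f`.
    _ ≤ wienerNorm f * wienerNorm ρ +
        ε * (C * (wienerNorm f * sobolevNorm k ρ + wienerNorm ρ * sobolevNorm k f)) +
        (C * wienerNorm ρ * wienerNorm f + wienerNorm ρ * (ε * sobolevNorm k f) +
          ε * C * sobolevNorm k ρ * (ε * sobolevNorm k f)) := le_self_add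
    _ = _ := by ring

/-- Lower semicontinuity of Sobolev norms. -/
lemma sobolevNorm_le_of_tendsto {F : ℕ → EuclideanSpace ℝ (Fin n) → ℝ}
    (hc : ∀ m, Continuous (F m)) {K : Set (EuclideanSpace ℝ (Fin n))} (hK : IsCompact K)
    (hFK : ∀ m, ∀ y ∉ K, F m y = 0) {B : ℝ} (hB : ∀ m y, |F m y| ≤ B)
    (hlim : ∀ y, Tendsto (fun m => F m y) atTop (𝓝 (g y))) {D : ℝ≥0∞}
    (hD : ∀ m, sobolevNorm k (F m) ≤ D) : sobolevNorm k g ≤ D := by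
  have hcs : ∀ m, HasCompactSupport (F m) := fun m => HasCompactSupport.intro hK (hFK m)
  -- The common bound `B` on the compact set `K` dominates, so Fourier transforms converge
  -- pointwise; Fatou's lemma for the weighted `L²` norm does the rest.
  have hFlim : ∀ ξ, Tendsto (fun m => realFourier (F m) ξ) atTop (𝓝 (realFourier g ξ)) := by
    intro ξ
    unfold realFourier
    simp only [Real.fourier_eq]
    refine tendsto_integral_of_dominated_convergence (K.indicator fun _ => B) (fun m => ?_) ?_
      (fun m => Eventually.of_forall fun y => ?_) (Eventually.of_forall fun y => ?_)
    · exact ((Real.fourierIntegral_convergent_iff ξ).2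
        (integrable_ofReal (hc m) (hcs m))).aestronglyMeasurable
    · exact (integrable_indicator_iff hK.measurableSet).2
        (integrableOn_const hK.measure_lt_top.ne)
    · rw [Circle.norm_smul, Complex.norm_real, Real.norm_eq_abs]
      by_cases hy : y ∈ K
      · simpa [hy] using hB m y
      · simp [hy, hFK m y hy]
    · exact ((Complex.continuous_ofReal.tendsto _).comp (hlim y)).const_smul _
  unfold sobolevNorm
  refine (Lp.eLpNorm_lim_le_liminf_eLpNorm (fun m => ?_) _
    (Eventually.of_forall fun ξ => (hFlim ξ).const_smul _)).trans ?_
  · have h1 := continuous_realFourier (hc m) (hcs m)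
    have h2 : Continuous fun ξ : EuclideanSpace ℝ (Fin n) => ((1 + ‖ξ‖ ^ 2) ^ (k / 2) : ℝ) :=
      Continuous.rpow_const (by fun_prop) fun ξ => Or.inl (by positivity)
    exact (h2.smul h1).aestronglyMeasurable
  · exact liminf_le_of_frequently_le' (Frequently.of_forall hD)

/-- Power series in a Sobolev function. -/
lemma mixedNorm_powerSeries_le (hk : (n : ℝ) / 2 < k) (hW : IsSobolev k W) (hρ : IsSobolev k ρ)
    {b : ℕ → ℝ} (hε : ε ≠ ⊤) {L : ℝ} (hL0 : 0 ≤ L)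
    (hL : ∀ f, IsSobolev k f → mixedNorm k ε (fun y => f y * ρ y) ≤
      ENNReal.ofReal L * mixedNorm k ε f)
    (hb : Summable fun m => |b m| * L ^ m)
    (hg : ∀ y, HasSum (fun m => b m * (W y * ρ y ^ m)) (g y)) :
    ε * sobolevNorm k g ≤ ENNReal.ofReal (∑' m, |b m| * L ^ m) * mixedNorm k ε W := by
  by_cases hε0 : ε = 0
  · simp [hε0]
  -- Only the norm `L` of multiplication by `ρ` enters, so `m` multiplications cost exactly `L ^ m`;
  -- the cut-off `W` stands in for the missing unit of the algebra.
  have hpow : ∀ m, IsSobolev k (fun y => W y * ρ y ^ m) ∧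
      mixedNorm k ε (fun y => W y * ρ y ^ m) ≤ ENNReal.ofReal (L ^ m) * mixedNorm k ε W := by
    intro m
    induction m with
    | zero => simpa using hW
    | succ m ih =>
      simp only [pow_succ, ← mul_assoc]
      refine ⟨ih.1.mul hk hρ, (hL _ ih.1).trans ?_⟩
      rw [ENNReal.ofReal_mul (by positivity), mul_comm (ENNReal.ofReal (L ^ m)), mul_assoc]
      exact mul_le_mul_right ih.2 _
  set D := ENNReal.ofReal (∑' m, |b m| * L ^ m) * mixedNorm k ε W
  have hsum : ∀ N, IsSobolev k (fun y => ∑ m ∈ Finset.range N, b m * (W y * ρ y ^ m)) ∧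
      mixedNorm k ε (fun y => ∑ m ∈ Finset.range N, b m * (W y * ρ y ^ m)) ≤
        ENNReal.ofReal (∑ m ∈ Finset.range N, |b m| * L ^ m) * mixedNorm k ε W := by
    intro N
    induction N with
    | zero =>
      have h0 := hW.const_mul 0
      have h1 := mixedNorm_const_mul (k := k) (ε := ε) 0 W
      simp only [zero_mul, enorm_zero] at h0 h1
      simpa using ⟨h0, h1⟩
    | succ N ih =>
      simp only [Finset.sum_range_succ]
      refine ⟨ih.1.add ((hpow N).1.const_mul _),
        (mixedNorm_add_le ih.1 ((hpow N).1.const_mul _)).trans ?_⟩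
      rw [ENNReal.ofReal_add (Finset.sum_nonneg fun _ _ => by positivity) (by positivity), add_mul]
      refine add_le_add ih.2 ?_
      rw [mixedNorm_const_mul, ENNReal.ofReal_mul (abs_nonneg _), mul_assoc,
        Real.enorm_eq_ofReal_abs]
      exact mul_le_mul_right (hpow N).2 _
  have hsD : ∀ N, mixedNorm k ε (fun y => ∑ m ∈ Finset.range N, b m * (W y * ρ y ^ m)) ≤ D :=
    fun N => (hsum N).2.trans (mul_le_mul_left (ENNReal.ofReal_le_ofReal
      (hb.sum_le_tsum _ fun _ _ => by positivity)) _)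
  have hDtop : D < ⊤ := ENNReal.mul_lt_top ENNReal.ofReal_lt_top (mixedNorm_lt_top hk hε hW)
  -- All partial sums live on the support of `W`, and their sup norms are at most their Wiener
  -- norms, hence at most `D`: lower semicontinuity applies.
  have hle : sobolevNorm k g ≤ D / ε := by
    refine sobolevNorm_le_of_tendsto (fun N => (hsum N).1.1) hW.2
      (fun N y hy => ?_) (B := D.toReal) (fun N y => ?_) (fun y => (hg y).tendsto_sum_nat)
      (fun N => ?_)
    · simp [image_eq_zero_of_notMem_tsupport hy]
    · have h1 : ‖∑ m ∈ Finset.range N, b m * (W y * ρ y ^ m)‖ₑ ≤ D :=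
        (enorm_le_wienerNorm (hsum N).1.1 (hsum N).1.2 y).trans (le_self_add.trans (hsD N))
      rw [Real.enorm_eq_ofReal_abs] at h1
      exact (ENNReal.ofReal_le_iff_le_toReal hDtop.ne).1 h1
    · rw [ENNReal.le_div_iff_mul_le (Or.inl hε0) (Or.inl hε), mul_comm]
      exact le_add_self.trans (hsD N)
  rw [mul_comm]
  exact (ENNReal.le_div_iff_mul_le (Or.inl hε0) (Or.inl hε)).1 hle

/-- The coefficients of the binomial series. -/
lemma hasSum_choose_mul_pow (s : ℝ) {x : ℝ} (hx : |x| < 1) :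
    HasSum (fun m => Ring.choose s m * x ^ m) ((1 + x) ^ s) := by
  have h := (Real.one_add_rpow_hasFPowerSeriesOnBall_zero (a := s)).hasSum (y := x)
    (by simpa [Metric.mem_eball, edist_dist, Real.dist_eq] using hx)
  simpa [binomialSeries, FormalMultilinearSeries.coeff_ofScalars, mul_comm] using h

lemma summable_abs_choose_mul_pow (s : ℝ) {x : ℝ} (hx0 : 0 ≤ x) (hx : x < 1) :
    Summable fun m => |Ring.choose s m| * x ^ m := by
  have h := (hasSum_choose_mul_pow s (x := x) (by rwa [abs_of_nonneg hx0])).summable.abs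
  simpa [abs_mul, abs_of_nonneg hx0] using h

/-- The second order remainder of `t ↦ (1 + t ρ)^s` in `H^k(ℝⁿ)`. -/
lemma tendsto_sobolevNorm_rpow_remainder (hk : (n : ℝ) / 2 < k) (hW : IsSobolev k W)
    (hρ : IsSobolev k ρ) (s : ℝ) :
    Tendsto (fun h : ℝ => sobolevNorm k
      (fun y => h⁻¹ * (W y * ((1 + h * ρ y) ^ s - 1 - s * (h * ρ y))))) (𝓝[≠] 0) (𝓝 0) := by
  set C := ENNReal.ofReal (2 ^ k)
  -- The bound of `mixedNorm_mul_le` with `ε = 1`. No localization is needed here, since `h ρ` is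
  -- small in the full norm for small `h`. `L` also bounds `ρ` pointwise.
  set Λ := ((1 + C) * wienerNorm ρ + 1 * C * sobolevNorm k ρ)
  have hΛ : Λ < ⊤ := by
    have := hρ.wienerNorm_lt_top hk
    have := hρ.3
    simp only [Λ, C]
    finiteness
  set L := Λ.toReal
  have hL : ENNReal.ofReal L = Λ := ENNReal.ofReal_toReal hΛ.ne
  have hL0 : 0 ≤ L := ENNReal.toReal_nonneg
  have hρL : ∀ y, |ρ y| ≤ L := fun y => by
    rw [← ENNReal.ofReal_le_ofReal_iff hL0, ← Real.enorm_eq_ofReal_abs, hL]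
    refine (enorm_le_wienerNorm hρ.1 hρ.2 y).trans (le_trans ?_ le_self_add)
    exact le_mul_of_one_le_left zero_le le_self_add
  -- Dropping the coefficients of order 0 and 1 leaves the series of the remainder.
  set b : ℕ → ℝ := fun m => if m < 2 then 0 else Ring.choose s m with hb
  have hbc : ∀ m, |b m| ≤ |Ring.choose s m| := fun m => by
    simp only [hb]; split_ifs <;> simp
  set B := ∑' m, |Ring.choose s m| * (1 / 2 : ℝ) ^ m
  have hsB := summable_abs_choose_mul_pow s (x := 1 / 2) (by norm_num) (by norm_num)
  have hN := mixedNorm_lt_top (ε := 1) hk (by simp) hW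
  have key : ∀ h : ℝ, h ≠ 0 → |h| * L ≤ 1 / 2 →
      sobolevNorm k (fun y => h⁻¹ * (W y * ((1 + h * ρ y) ^ s - 1 - s * (h * ρ y)))) ≤
        ENNReal.ofReal |h| * (ENNReal.ofReal ((2 * L) ^ 2 * B) * mixedNorm k 1 W) := by
    intro h hh hhL
    have hr0 : 0 ≤ |h| * L := by positivity
    -- For `m ≥ 2` and `|h| L ≤ 1/2`, two factors `|h| L` are kept and the others are replaced by
    -- `1/2`. Of the resulting `h²` one power is spent on `h⁻¹`.
    have hle : ∀ m, |b m| * (|h| * L) ^ m ≤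
        (2 * (|h| * L)) ^ 2 * (|Ring.choose s m| * (1 / 2 : ℝ) ^ m) := by
      intro m
      by_cases hm : m < 2
      · simp only [hb, hm, if_true, abs_zero, zero_mul]; positivity
      · obtain ⟨j, rfl⟩ : ∃ j, m = j + 2 := ⟨m - 2, by omega⟩
        have h1 : (|h| * L) ^ (j + 2) ≤ (2 * (|h| * L)) ^ 2 * (1 / 2 : ℝ) ^ (j + 2) := by
          have h2 : (|h| * L) ^ j ≤ (1 / 2 : ℝ) ^ j := pow_le_pow_left₀ hr0 hhL j
          rw [pow_add, pow_add (1 / 2 : ℝ)]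
          nlinarith [mul_le_mul_of_nonneg_right h2 (sq_nonneg (|h| * L))]
        calc |b (j + 2)| * (|h| * L) ^ (j + 2)
            ≤ |Ring.choose s (j + 2)| * ((2 * (|h| * L)) ^ 2 * (1 / 2 : ℝ) ^ (j + 2)) :=
              mul_le_mul (hbc _) h1 (by positivity) (abs_nonneg _)
          _ = _ := by ring
    have hsum : Summable fun m => |b m| * (|h| * L) ^ m :=
      Summable.of_nonneg_of_le (fun _ => by positivity) hle (hsB.mul_left _)
    have htsum : ∑' m, |b m| * (|h| * L) ^ m ≤ (2 * (|h| * L)) ^ 2 * B := by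
      rw [← tsum_mul_left]
      exact hsum.tsum_le_tsum hle (hsB.mul_left _)
    have hser := mixedNorm_powerSeries_le (ε := 1) (b := b)
      (g := fun y => W y * ((1 + h * ρ y) ^ s - 1 - s * (h * ρ y))) hk hW (hρ.const_mul h)
      (by simp) hr0 (fun f hf => ?_) hsum (fun y => ?_)
    · rw [sobolevNorm_const_mul]
      rw [one_mul] at hser
      calc _ ≤ ‖h⁻¹‖ₑ * (ENNReal.ofReal ((2 * (|h| * L)) ^ 2 * B) * mixedNorm k 1 W) :=
            mul_le_mul_right (hser.trans (mul_le_mul_left (ENNReal.ofReal_le_ofReal htsum) _)) _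
        _ = _ := by
            rw [← mul_assoc (‖h⁻¹‖ₑ), ← mul_assoc (ENNReal.ofReal |h|), Real.enorm_eq_ofReal_abs,
              ← ENNReal.ofReal_mul (abs_nonneg _), ← ENNReal.ofReal_mul (abs_nonneg _)]
            congr 2
            have : |h| ≠ 0 := abs_ne_zero.2 hh
            rw [abs_inv]
            field_simp
    · have e : (fun y => f y * (h * ρ y)) = fun y => h * (f y * ρ y) := by ext y; ring
      rw [e, mixedNorm_const_mul, ENNReal.ofReal_mul (abs_nonneg _), hL, mul_assoc,
        Real.enorm_eq_ofReal_abs]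
      exact mul_le_mul_right (mixedNorm_mul_le hk hf hρ) _
    · have hx : |h * ρ y| < 1 := by
        rw [abs_mul]
        exact lt_of_le_of_lt (mul_le_mul_of_nonneg_left (hρL y) (abs_nonneg _)) (by linarith)
      have h1 := hasSum_choose_mul_pow s hx
      have h2 := (hasSum_nat_add_iff' 2).2 h1
      have h3 : HasSum (fun m => b m * (h * ρ y) ^ m) ((1 + h * ρ y) ^ s - 1 - s * (h * ρ y)) := by
        rw [← hasSum_nat_add_iff' 2]
        convert! h2 using 1
        · simp [Finset.sum_range_succ, hb]
          ring
      refine (h3.mul_left (W y)).congr_fun ?_ 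
      intro m
      ring
  have hlim : Tendsto (fun h : ℝ =>
      ENNReal.ofReal |h| * (ENNReal.ofReal ((2 * L) ^ 2 * B) * mixedNorm k 1 W)) (𝓝[≠] 0) (𝓝 0) := by
    have h1 : Tendsto (fun h : ℝ => ENNReal.ofReal |h|) (𝓝[≠] 0) (𝓝 0) := by
      have : Tendsto (fun h : ℝ => ENNReal.ofReal |h|) (𝓝 0) (𝓝 (ENNReal.ofReal |0|)) :=
        (ENNReal.continuous_ofReal.comp continuous_abs).tendsto 0
      rw [abs_zero, ENNReal.ofReal_zero] at this
      exact this.mono_left nhdsWithin_le_nhds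
    have h2 := ENNReal.Tendsto.mul_const h1
      (b := ENNReal.ofReal ((2 * L) ^ 2 * B) * mixedNorm k 1 W)
      (Or.inr (ENNReal.mul_lt_top ENNReal.ofReal_lt_top hN).ne)
    rwa [zero_mul] at h2
  refine tendsto_of_tendsto_of_tendsto_of_le_of_le' tendsto_const_nhds hlim
    (Eventually.of_forall fun _ => zero_le) ?_
  have hev : ∀ᶠ h : ℝ in 𝓝 0, |h| * L < 1 / 2 := by
    have : ContinuousAt (fun h : ℝ => |h| * L) 0 := by fun_prop
    exact this.eventually_lt_const (by simp)
  filter_upwards [self_mem_nhdsWithin, nhdsWithin_le_nhds hev] with h h1 h2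
  exact key h h1 h2.le

/-- The derivatives of `g` are controlled by Sobolev norms of large order. -/
lemma exists_iSup_iteratedFDeriv_le_sobolevNorm (j : ℕ) (hk : (n : ℝ) / 2 + j < k) :
    ∃ C : ℝ≥0∞, C ≠ ⊤ ∧ ∀ g : EuclideanSpace ℝ (Fin n) → ℝ, Continuous g → HasCompactSupport g →
      ⨆ y, ‖iteratedFDeriv ℝ j g y‖ₑ ≤ C * sobolevNorm k g := by
  obtain ⟨C, hC, hCg⟩ := exists_lintegral_weight_le_sobolevNorm (n := n) j k hk
  set A := (2 * Real.pi * ‖innerSL ℝ (E := EuclideanSpace ℝ (Fin n))‖) ^ j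
  -- The summand `1` makes the constant nonzero, so that the right side is `⊤` when the Sobolev norm
  -- is (`0 * ⊤ = 0` in `ℝ≥0∞`).
  refine ⟨ENNReal.ofReal (‖Complex.reCLM‖ * A) * C + 1, by finiteness, fun g hg hs => ?_⟩
  by_cases htop : sobolevNorm k g = ⊤
  · rw [htop, ENNReal.mul_top (by simp)]; exact le_top
  have hlt : ∫⁻ ξ, weight j ξ * ‖realFourier g ξ‖ₑ < ⊤ :=
    (hCg g hg hs).trans_lt (ENNReal.mul_lt_top hC.lt_top (Ne.lt_top htop))
  have hcont := continuous_realFourier hg hs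
  have hpw : ∀ i : ℕ, i ≤ j → ∀ ξ : EuclideanSpace ℝ (Fin n),
      ‖(‖ξ‖ ^ i * ‖realFourier g ξ‖ : ℝ)‖ₑ ≤ weight j ξ * ‖realFourier g ξ‖ₑ := by
    intro i hi ξ
    rw [enorm_mul, enorm_norm, Real.enorm_of_nonneg (by positivity)]
    refine mul_le_mul_left (ENNReal.ofReal_le_ofReal ?_) _
    have h1 : (1 : ℝ) ≤ 1 + ‖ξ‖ ^ 2 := by nlinarith [norm_nonneg ξ]
    have h2 : ‖ξ‖ ≤ √(1 + ‖ξ‖ ^ 2) := Real.le_sqrt_of_sq_le (by linarith)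
    calc ‖ξ‖ ^ i ≤ √(1 + ‖ξ‖ ^ 2) ^ i := pow_le_pow_left₀ (norm_nonneg _) h2 i
      _ ≤ √(1 + ‖ξ‖ ^ 2) ^ j := pow_le_pow_right₀ (Real.one_le_sqrt.2 h1) hi
      _ = (1 + ‖ξ‖ ^ 2) ^ ((j : ℝ) / 2) := by
        rw [Real.sqrt_eq_rpow, ← Real.rpow_natCast, ← Real.rpow_mul (by positivity)]
        congr 1
        ring
  have hint : ∀ i : ℕ, (i : ℕ∞) ≤ (j : ℕ∞) →
      Integrable (fun ξ => ‖ξ‖ ^ i * ‖realFourier g ξ‖) := by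
    intro i hi
    refine ⟨(by fun_prop : Continuous fun ξ => ‖ξ‖ ^ i * ‖realFourier g ξ‖).aestronglyMeasurable,
      lt_of_le_of_lt (lintegral_mono (hpw i (by exact_mod_cast hi))) hlt⟩
  have hw : wienerNorm g ≠ ⊤ := by
    have h0 := (hint 0 (by simp)).2
    simp only [pow_zero, one_mul, hasFiniteIntegral_norm_iff] at h0
    exact h0.ne
  -- By inversion `g` is itself a Fourier transform up to reflection, of a function with integrable
  -- moments up to order `j`, so its derivatives are obtained under the integral.
  have hG : g = Complex.reCLM ∘ (𝓕 (realFourier g) ∘ LinearIsometryEquiv.neg ℝ) := by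
    ext y
    have h := fourierInv_realFourier hg hs hw y
    rw [Real.fourierInv_eq_fourier_neg] at h
    simp [Function.comp_def, h]
  have hsm : ContDiff ℝ (j : ℕ∞) (𝓕 (realFourier g)) := Real.contDiff_fourier hint
  refine iSup_le fun y => ?_
  have h1 : ‖iteratedFDeriv ℝ j g y‖ ≤
      ‖Complex.reCLM‖ * ‖iteratedFDeriv ℝ j (𝓕 (realFourier g)) (-y)‖ := by
    conv_lhs => rw [hG]
    refine (ContinuousLinearMap.norm_iteratedFDeriv_comp_left Complex.reCLM
      (hsm.comp (LinearIsometryEquiv.neg ℝ).contDiff).contDiffAt le_rfl).trans ?_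
    rw [LinearIsometryEquiv.norm_iteratedFDeriv_comp_right]
    rfl
  have h2 : ‖iteratedFDeriv ℝ j (𝓕 (realFourier g)) (-y)‖ₑ ≤
      ENNReal.ofReal A * (C * sobolevNorm k g) := by
    rw [Real.iteratedFDeriv_fourier hint hcont.aestronglyMeasurable le_rfl, Real.fourier_eq]
    refine (enorm_integral_le_lintegral_enorm _).trans ?_
    refine le_trans ?_ (mul_le_mul_right (hCg g hg hs) _)
    rw [← lintegral_const_mul' _ _ ENNReal.ofReal_ne_top]
    refine lintegral_mono fun ξ => ?_
    refine le_trans ?_ (mul_le_mul_right (hpw j le_rfl ξ) _)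
    have h3 := VectorFourier.norm_fourierPowSMulRight_le (innerSL ℝ) (realFourier g) ξ j
    rw [← Real.enorm_of_nonneg (by positivity : 0 ≤ A), ← enorm_mul, enorm_le_iff_norm_le,
      Circle.norm_smul, Real.norm_of_nonneg (by positivity)]
    refine h3.trans (le_of_eq ?_)
    ring
  calc ‖iteratedFDeriv ℝ j g y‖ₑ
      ≤ ENNReal.ofReal ‖Complex.reCLM‖ * ‖iteratedFDeriv ℝ j (𝓕 (realFourier g)) (-y)‖ₑ := by
        rw [← ofReal_norm, ← ofReal_norm, ← ENNReal.ofReal_mul (norm_nonneg _)]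
        exact ENNReal.ofReal_le_ofReal h1
    _ ≤ ENNReal.ofReal ‖Complex.reCLM‖ * (ENNReal.ofReal A * (C * sobolevNorm k g)) :=
        mul_le_mul_right h2 _
    _ = ENNReal.ofReal (‖Complex.reCLM‖ * A) * C * sobolevNorm k g := by
        rw [ENNReal.ofReal_mul (norm_nonneg _)]; ring
    _ ≤ _ := mul_le_mul_left le_self_add _

end SobolevFunctions

/-! ### Local smallness in the Wiener algebra and real powers of Sobolev functions -/

section Localization

variable {n : ℕ}

/-- Translations are continuous in `L¹`. -/
lemma tendsto_lintegral_translate_sub {Φ : EuclideanSpace ℝ (Fin n) → ℂ} (hΦ : Integrable Φ) :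
    Tendsto (fun h => ∫⁻ ξ, ‖Φ (h + ξ) - Φ ξ‖ₑ) (𝓝 0) (𝓝 0) := by
  have : Fact ((1 : ℝ≥0∞) ≠ ⊤) := ⟨by simp⟩
  have hm : MemLp Φ 1 volume := memLp_one_iff_integrable.2 hΦ
  -- The translation action on `Lp` is continuous for finite exponents.
  have hcont : Continuous fun h : EuclideanSpace ℝ (Fin n) =>
      edist (DomAddAct.mk h +ᵥ hm.toLp) hm.toLp := by
    have h1 : Continuous fun h : EuclideanSpace ℝ (Fin n) => DomAddAct.mk h :=
      DomAddAct.mkHomeomorph.continuous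
    exact (h1.vadd continuous_const).edist continuous_const
  have h0 := hcont.tendsto 0
  have e : ∀ h : EuclideanSpace ℝ (Fin n), edist (DomAddAct.mk h +ᵥ hm.toLp) hm.toLp =
      ∫⁻ ξ, ‖Φ (h + ξ) - Φ ξ‖ₑ := by
    intro h
    rw [DomAddAct.mk_vadd_toLp, Lp.edist_toLp_toLp, eLpNorm_one_eq_lintegral_enorm]
    rfl
  simp only [e, zero_add, sub_self, enorm_zero, lintegral_zero] at h0
  exact h0

lemma realFourier_comp_inv_smul_sub (φ : EuclideanSpace ℝ (Fin n) → ℝ) {r : ℝ} (hr : 0 < r)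
    (x₀ ξ : EuclideanSpace ℝ (Fin n)) :
    realFourier (fun x => φ (r⁻¹ • (x - x₀))) ξ =
      (r ^ n : ℝ) * ((Real.fourierChar (-inner ℝ x₀ ξ) : ℂ) * realFourier φ (r • ξ)) := by
  unfold realFourier
  rw [Real.fourier_eq, Real.fourier_eq]
  set F : EuclideanSpace ℝ (Fin n) → ℂ := fun y =>
    (Real.fourierChar (-inner ℝ x₀ ξ) : ℂ) * (Real.fourierChar (-inner ℝ y (r • ξ)) • (φ y : ℂ))
  have e : ∀ x, Real.fourierChar (-inner ℝ x ξ) • (φ (r⁻¹ • (x - x₀)) : ℂ) =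
      F (r⁻¹ • (x - x₀)) := by
    intro x
    have h1 : -inner ℝ x ξ = -inner ℝ x₀ ξ + -inner ℝ (r⁻¹ • (x - x₀)) (r • ξ) := by
      rw [inner_smul_left, inner_smul_right, inner_sub_left]
      simp
      field_simp
      ring
    simp only [F]
    rw [h1, AddChar.map_add_eq_mul, Circle.smul_def, Circle.smul_def, Circle.coe_mul, smul_eq_mul,
      smul_eq_mul, mul_assoc]
  simp only [e]
  rw [integral_sub_right_eq_self (fun x => F (r⁻¹ • x)) x₀,
    Measure.integral_comp_inv_smul_of_nonneg volume F hr.le, finrank_euclideanSpace_fin]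
  simp only [F]
  rw [integral_const_mul, Complex.real_smul]

lemma norm_realFourier_le {g : EuclideanSpace ℝ (Fin n) → ℝ} (ξ : EuclideanSpace ℝ (Fin n)) :
    ‖realFourier g ξ‖ ≤ ∫ y, |g y| := by
  refine (VectorFourier.norm_fourierIntegral_le_integral_norm _ _ _ _ _).trans (le_of_eq ?_)
  simp

/-- Localizing `g - g x₀` in a ball of radius of order `r` about `x₀`. -/
lemma wienerNorm_localized_sub_le {g φ : EuclideanSpace ℝ (Fin n) → ℝ} (hg : Continuous g)
    (hgs : HasCompactSupport g) (hw : wienerNorm g ≠ ⊤) (hφ : Continuous φ)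
    (hφs : HasCompactSupport φ) (x₀ : EuclideanSpace ℝ (Fin n)) {r : ℝ} (hr : 0 < r) :
    wienerNorm (fun y => φ (r⁻¹ • (y - x₀)) * (g y - g x₀)) ≤
      ∫⁻ η, ‖realFourier g η‖ₑ *
        ∫⁻ ξ, ‖realFourier φ (-(r • η) + ξ) - realFourier φ ξ‖ₑ := by
  set ψ : EuclideanSpace ℝ (Fin n) → ℝ := fun y => φ (r⁻¹ • (y - x₀)) with hψ
  have hψc : Continuous ψ := hφ.comp (by fun_prop)
  have hψs : HasCompactSupport ψ := by
    have h1 := hφs.comp_homeomorph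
      ((Homeomorph.subRight x₀).trans (Homeomorph.smulOfNeZero r⁻¹ (inv_ne_zero hr.ne')))
    exact h1
  have mG := continuous_realFourier hg hgs
  have mΦ := continuous_realFourier hφ hφs
  have hGi := integrable_realFourier hg hgs hw
  have hψF := continuous_realFourier hψc hψs
  have hΨ := realFourier_comp_inv_smul_sub φ hr x₀
  have hinv := fourierInv_realFourier hg hgs hw x₀
  rw [Real.fourierInv_eq] at hinv
  -- The product `g ψ` becomes a convolution, and the constant `g x₀` is expanded by Fourier
  -- inversion, so both terms are integrals against the transform of `g`.
  have hform : ∀ ξ, realFourier (fun y => ψ y * (g y - g x₀)) ξ =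
      ∫ η, realFourier g η * (realFourier ψ (ξ - η) -
        Real.fourierChar (inner ℝ η x₀) * realFourier ψ ξ) := by
    intro ξ
    have e1 : (fun y => ψ y * (g y - g x₀)) = fun y => g y * ψ y + (-g x₀) * ψ y := by
      ext y; ring
    have hi1 : Integrable fun η => realFourier g η * realFourier ψ (ξ - η) :=
      hGi.mul_bdd (c := ∫ y, |ψ y|)
        (by fun_prop : Continuous fun η => realFourier ψ (ξ - η)).aestronglyMeasurable
        (Eventually.of_forall fun η => norm_realFourier_le _)
    have hi2 : Integrable fun η : EuclideanSpace ℝ (Fin n) =>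
        (Real.fourierChar (inner ℝ η x₀) • realFourier g η) * realFourier ψ ξ := by
      refine Integrable.mul_const ?_ _
      have := (Real.fourierIntegral_convergent_iff (-x₀)).2 hGi
      simpa using this
    rw [e1, realFourier_add (f := fun y => g y * ψ y) (g := fun y => -g x₀ * ψ y)
        (hg.mul hψc) hgs.mul_right (continuous_const.mul hψc) hψs.mul_left,
      realFourier_mul hg hgs hψc hψs hw, realFourier_const_mul, Complex.ofReal_neg, ← hinv,
      neg_mul, ← integral_mul_const, ← sub_eq_add_neg, ← integral_sub hi1 hi2]
    congr 1 with η
    rw [Circle.smul_def, smul_eq_mul]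
    ring
  -- The phase produced by centring `ψ` at `x₀` is the same in both terms and has modulus one. What
  -- remains is a translate of the transform of `φ` by `r η` minus the transform itself.
  have hnorm : ∀ ξ η, ‖realFourier ψ (ξ - η) -
      Real.fourierChar (inner ℝ η x₀) * realFourier ψ ξ‖ₑ = ENNReal.ofReal (r ^ n) *
        ‖realFourier φ (-(r • η) + r • ξ) - realFourier φ (r • ξ)‖ₑ := by
    intro ξ η
    have h1 : -inner ℝ x₀ (ξ - η) = inner ℝ η x₀ + -inner ℝ x₀ ξ := by
      rw [inner_sub_right, real_inner_comm x₀ η]; ring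
    rw [hψ, hΨ, hΨ, h1, AddChar.map_add_eq_mul, Circle.coe_mul]
    have h2 : ((r ^ n : ℝ) : ℂ) * ((Real.fourierChar (inner ℝ η x₀) : ℂ) *
        (Real.fourierChar (-inner ℝ x₀ ξ) : ℂ) * realFourier φ (r • (ξ - η))) -
        (Real.fourierChar (inner ℝ η x₀) : ℂ) * (((r ^ n : ℝ) : ℂ) *
        ((Real.fourierChar (-inner ℝ x₀ ξ) : ℂ) * realFourier φ (r • ξ))) =
        ((r ^ n : ℝ) : ℂ) * ((Real.fourierChar (inner ℝ η x₀) : ℂ) *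
        ((Real.fourierChar (-inner ℝ x₀ ξ) : ℂ) *
          (realFourier φ (-(r • η) + r • ξ) - realFourier φ (r • ξ)))) := by
      have h3 : r • (ξ - η) = -(r • η) + r • ξ := by rw [smul_sub]; abel
      rw [h3]; ring
    rw [h2, ← Real.enorm_of_nonneg (by positivity : 0 ≤ r ^ n), ← enorm_norm (_ - _),
      ← enorm_mul, enorm_eq_iff_norm_eq, norm_mul, norm_mul, norm_mul, norm_mul, Circle.norm_coe,
      Circle.norm_coe, one_mul, one_mul, norm_norm, Complex.norm_real]
  -- The dilation by `r` absorbs the Jacobian `r ^ n`: in the `L¹` norm, `r` survives only in the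
  -- translation.
  have hscale : ∀ η, ∫⁻ ξ, ENNReal.ofReal (r ^ n) *
      ‖realFourier φ (-(r • η) + r • ξ) - realFourier φ (r • ξ)‖ₑ =
      ∫⁻ ξ, ‖realFourier φ (-(r • η) + ξ) - realFourier φ ξ‖ₑ := by
    intro η
    have h1 : Measurable fun ξ => ‖realFourier φ (-(r • η) + ξ) - realFourier φ ξ‖ₑ := by fun_prop
    have h2 := lintegral_map h1 (μ := volume) (measurable_const_smul r)
    rw [Measure.map_addHaar_smul _ hr.ne', lintegral_smul_measure, finrank_euclideanSpace_fin] at h2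
    rw [lintegral_const_mul _ (by fun_prop), ← h2, smul_eq_mul, ← mul_assoc,
      ← ENNReal.ofReal_mul (by positivity), abs_of_nonneg (by positivity),
      mul_inv_cancel₀ (by positivity), ENNReal.ofReal_one, one_mul]
  calc wienerNorm (fun y => ψ y * (g y - g x₀))
      ≤ ∫⁻ ξ, ∫⁻ η, ‖realFourier g η‖ₑ * (ENNReal.ofReal (r ^ n) *
        ‖realFourier φ (-(r • η) + r • ξ) - realFourier φ (r • ξ)‖ₑ) := by
        refine lintegral_mono fun ξ => ?_
        rw [hform]
        refine (enorm_integral_le_lintegral_enorm _).trans (le_of_eq ?_)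
        refine lintegral_congr fun η => ?_
        rw [enorm_mul, hnorm]
    _ = ∫⁻ η, ∫⁻ ξ, ‖realFourier g η‖ₑ * (ENNReal.ofReal (r ^ n) *
        ‖realFourier φ (-(r • η) + r • ξ) - realFourier φ (r • ξ)‖ₑ) := by
        rw [lintegral_lintegral_swap]
        refine Measurable.aemeasurable ?_
        have mG' := mG.measurable
        have mΦ' := mΦ.measurable
        simp only [Function.uncurry_def]
        fun_prop
    _ = _ := by
        refine lintegral_congr fun η => ?_
        rw [lintegral_const_mul _ (by fun_prop), hscale]

/-- A function in the Wiener algebra is locally close to constants. -/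
lemma exists_cutoff_wienerNorm_le {g : EuclideanSpace ℝ (Fin n) → ℝ} (hg : Continuous g)
    (hgs : HasCompactSupport g) (hw : wienerNorm g ≠ ⊤) (x₀ : EuclideanSpace ℝ (Fin n))
    {δ : ℝ≥0∞} (hδ : δ ≠ 0) :
    ∃ φ : EuclideanSpace ℝ (Fin n) → ℝ, ContDiff ℝ ∞ φ ∧ HasCompactSupport φ ∧
      (∀ᶠ y in 𝓝 x₀, φ y = 1) ∧ wienerNorm (fun y => φ y * (g y - g x₀)) ≤ δ := by
  set β : ContDiffBump (0 : EuclideanSpace ℝ (Fin n)) := ⟨1, 2, by norm_num, by norm_num⟩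
  set φ : EuclideanSpace ℝ (Fin n) → ℝ := fun y => β y
  have hφ : ContDiff ℝ ∞ φ := β.contDiff
  have hφs : HasCompactSupport φ := β.hasCompactSupport
  have hφw : wienerNorm φ < ⊤ :=
    (IsSobolev.of_contDiff ((n : ℝ) / 2 + 1) hφ hφs).wienerNorm_lt_top (by linarith)
  have hΦ := integrable_realFourier hφ.continuous hφs hφw.ne
  have mΦ := continuous_realFourier hφ.continuous hφs
  have mG := continuous_realFourier hg hgs
  -- As `r → 0` the translation by `r η` tends to zero for each `η`; the inner integral is at most
  -- twice the Wiener norm of `φ`, so dominated convergence applies.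
  have hlim : Tendsto (fun r : ℝ => ∫⁻ η, ‖realFourier g η‖ₑ *
      ∫⁻ ξ, ‖realFourier φ (-(r • η) + ξ) - realFourier φ ξ‖ₑ) (𝓝[>] 0)
      (𝓝 (∫⁻ _ : EuclideanSpace ℝ (Fin n), 0)) := by
    refine tendsto_lintegral_filter_of_dominated_convergence
      (fun η => ‖realFourier g η‖ₑ * (wienerNorm φ + wienerNorm φ))
      (Eventually.of_forall fun r => ?_)
      (Eventually.of_forall fun r => Eventually.of_forall fun η => ?_) ?_
      (Eventually.of_forall fun η => ?_)
    · refine mG.enorm.measurable.mul (Measurable.lintegral_prod_right'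
        (f := fun z : EuclideanSpace ℝ (Fin n) × EuclideanSpace ℝ (Fin n) =>
          ‖realFourier φ (-(r • z.1) + z.2) - realFourier φ z.2‖ₑ) ?_)
      fun_prop
    · refine mul_le_mul_right ?_ _
      calc ∫⁻ ξ, ‖realFourier φ (-(r • η) + ξ) - realFourier φ ξ‖ₑ
          ≤ ∫⁻ ξ, (‖realFourier φ (-(r • η) + ξ)‖ₑ + ‖realFourier φ ξ‖ₑ) :=
            lintegral_mono fun ξ => enorm_sub_le
        _ = _ := by
            rw [lintegral_add_right _ mΦ.enorm.measurable,
              lintegral_add_left_eq_self (fun ξ => ‖realFourier φ ξ‖ₑ)]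
            rfl
    · rw [lintegral_mul_const _ mG.enorm.measurable]
      exact ENNReal.mul_ne_top hw (ENNReal.add_ne_top.2 ⟨hφw.ne, hφw.ne⟩)
    · have h1 : Tendsto (fun r : ℝ => -(r • η)) (𝓝[>] 0) (𝓝 0) := by
        have : Continuous fun r : ℝ => -(r • η) := by fun_prop
        simpa using (this.tendsto 0).mono_left nhdsWithin_le_nhds
      have h2 := ENNReal.Tendsto.const_mul (a := ‖realFourier g η‖ₑ)
        ((tendsto_lintegral_translate_sub hΦ).comp h1) (Or.inr enorm_ne_top)
      simpa using h2
  rw [lintegral_zero] at hlim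
  have hev := hlim.eventually (eventually_le_nhds (pos_iff_ne_zero.2 hδ))
  obtain ⟨r, hr1, hr0⟩ := (hev.and self_mem_nhdsWithin).exists
  have hr0 : 0 < r := hr0
  refine ⟨fun y => φ (r⁻¹ • (y - x₀)), hφ.comp (by fun_prop), ?_, ?_,
    (wienerNorm_localized_sub_le hg hgs hw hφ.continuous hφs x₀ hr0).trans hr1⟩
  · exact hφs.comp_homeomorph
      ((Homeomorph.subRight x₀).trans (Homeomorph.smulOfNeZero r⁻¹ (inv_ne_zero hr0.ne')))
  · have h1 : Tendsto (fun y : EuclideanSpace ℝ (Fin n) => r⁻¹ • (y - x₀)) (𝓝 x₀) (𝓝 0) := by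
      have : Continuous fun y : EuclideanSpace ℝ (Fin n) => r⁻¹ • (y - x₀) := by fun_prop
      simpa using this.tendsto x₀
    exact h1.eventually β.eventuallyEq_one

variable {k : ℝ} {g : EuclideanSpace ℝ (Fin n) → ℝ}

/-- Near `x` write `g = c (1 + ρ)` with `ρ` small in Wiener norm, and expand `(1 + ρ)^s` in the
binomial series. The cut-off `b` is chosen before `χ`, so that it still serves after `χ` has been
multiplied by other cut-offs. -/
lemma exists_cutoff_sobolevNorm_rpow_lt_top (hk : (n : ℝ) / 2 < k) (hg : IsSobolev k g) (s : ℝ)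
    {x : EuclideanSpace ℝ (Fin n)} (hx : 0 < g x) :
    ∃ b : EuclideanSpace ℝ (Fin n) → ℝ, ContDiff ℝ ∞ b ∧ (∀ᶠ y in 𝓝 x, b y = 1) ∧
      ∀ χ : EuclideanSpace ℝ (Fin n) → ℝ, ContDiff ℝ ∞ χ → HasCompactSupport χ →
        sobolevNorm k (fun y => χ y * b y * g y ^ s) < ⊤ := by
  set c := g x
  set C := ENNReal.ofReal (2 ^ k) with hC
  have h2k : (0 : ℝ) < 2 ^ k := by positivity
  -- The tolerance is chosen so that, after division by `c`, the Wiener part of the multiplication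
  -- norm is at most `1/4`.
  obtain ⟨φ, hφ, hφs, hφ1, hφw⟩ := exists_cutoff_wienerNorm_le hg.1 hg.2
    (hg.wienerNorm_lt_top hk).ne x (δ := ENNReal.ofReal (c / (4 * (1 + 2 ^ k))))
    (by rw [ne_eq, ENNReal.ofReal_eq_zero, not_le]; positivity)
  set ρ : EuclideanSpace ℝ (Fin n) → ℝ := fun y => c⁻¹ * (φ y * (g y - c)) with hρd
  have hφS := IsSobolev.of_contDiff k hφ hφs
  have hρ : IsSobolev k ρ := by
    have h1 := ((hφS.mul hk hg).add (hφS.const_mul (-c))).const_mul c⁻¹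
    convert! h1 using 2
    simp only [hρd]
    ring
  have hwρ : (1 + C) * wienerNorm ρ ≤ ENNReal.ofReal (1 / 4) := by
    rw [wienerNorm_const_mul, Real.enorm_of_nonneg (inv_nonneg.2 hx.le)]
    have e1 : 1 + C = ENNReal.ofReal (1 + 2 ^ k) := by
      rw [ENNReal.ofReal_add zero_le_one h2k.le, ENNReal.ofReal_one]
    rw [e1]
    refine (mul_le_mul_right (mul_le_mul_right hφw _) _).trans (le_of_eq ?_)
    rw [← ENNReal.ofReal_mul (inv_nonneg.2 hx.le), ← ENNReal.ofReal_mul (by positivity)]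
    congr 1
    have : c ≠ 0 := hx.ne'
    field_simp
  have hρle : ∀ y, |ρ y| ≤ 1 / 4 := fun y => by
    rw [← ENNReal.ofReal_le_ofReal_iff (by norm_num), ← Real.enorm_eq_ofReal_abs]
    refine (enorm_le_wienerNorm hρ.1 hρ.2 y).trans (le_trans ?_ hwρ)
    exact le_mul_of_one_le_left zero_le le_self_add
  -- The Sobolev norm of `ρ` is only finite; the weight `ε` brings its contribution below `1/4`, for
  -- a total multiplication norm of `1/2`.
  obtain ⟨ε, hε0, hεt, hε⟩ : ∃ ε : ℝ≥0∞, ε ≠ 0 ∧ ε ≠ ⊤ ∧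
      ε * C * sobolevNorm k ρ ≤ ENNReal.ofReal (1 / 4) := by
    set X := (C * sobolevNorm k ρ).toReal
    have hX : C * sobolevNorm k ρ = ENNReal.ofReal X :=
      (ENNReal.ofReal_toReal (ENNReal.mul_lt_top ENNReal.ofReal_lt_top hρ.3).ne).symm
    have hX0 : 0 ≤ X := ENNReal.toReal_nonneg
    refine ⟨ENNReal.ofReal (1 / (4 * (X + 1))), ?_, ENNReal.ofReal_ne_top, ?_⟩
    · rw [ne_eq, ENNReal.ofReal_eq_zero, not_le]; positivity
    · rw [mul_assoc, hX, ← ENNReal.ofReal_mul (by positivity)]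
      refine ENNReal.ofReal_le_ofReal ?_
      rw [one_div_mul_eq_div, div_le_div_iff₀ (by positivity) (by norm_num)]
      linarith
  have hL : ∀ f, IsSobolev k f → mixedNorm k ε (fun y => f y * ρ y) ≤
      ENNReal.ofReal (1 / 2) * mixedNorm k ε f := fun f hf => by
    refine (mixedNorm_mul_le hk hf hρ).trans (mul_le_mul_left ?_ _)
    refine (add_le_add hwρ hε).trans (le_of_eq ?_)
    rw [← ENNReal.ofReal_add (by norm_num) (by norm_num)]
    norm_num
  obtain ⟨r, hr0, hr⟩ := Metric.eventually_nhds_iff_ball.1 hφ1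
  -- The bump is supported where `φ = 1`, and there `g = c (1 + ρ)` exactly.
  set β : ContDiffBump x := ⟨r / 3, r / 2, by positivity, by linarith⟩
  refine ⟨β, β.contDiff, β.eventuallyEq_one, fun χ hχ hχs => ?_⟩
  have hW : IsSobolev k (fun y => χ y * β y) :=
    IsSobolev.of_contDiff k (hχ.mul β.contDiff) hχs.mul_right
  have hser := mixedNorm_powerSeries_le (b := fun m => c ^ s * Ring.choose s m)
    (g := fun y => χ y * β y * g y ^ s) hk hW hρ hεt (by norm_num) hL ?_ fun y => ?_
  · have hfin : ε * sobolevNorm k (fun y => χ y * β y * g y ^ s) < ⊤ :=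
      hser.trans_lt (ENNReal.mul_lt_top ENNReal.ofReal_lt_top (mixedNorm_lt_top hk hεt hW))
    exact (ENNReal.lt_top_of_mul_ne_top_right hfin.ne hε0)
  · have := (summable_abs_choose_mul_pow s (x := 1 / 2) (by norm_num) (by norm_num)).mul_left |c ^ s|
    simpa only [abs_mul, mul_assoc] using this
  · by_cases hy : β y = 0
    · simp [hy]
    · have hyr : y ∈ Metric.ball x r := by
        have h1 : y ∈ Function.support β := hy
        rw [β.support_eq] at h1
        exact Metric.ball_subset_ball (by simp only [β]; linarith) h1
      have h2 : g y = c * (1 + ρ y) := by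
        have : c ≠ 0 := hx.ne'
        simp only [hρd, hr y hyr]
        field_simp
        ring
      have h3 := hρle y
      have h4 := hasSum_choose_mul_pow s (x := ρ y) (by linarith)
      rw [h2, Real.mul_rpow hx.le (by linarith [(abs_le.1 h3).1])]
      have h5 := h4.mul_left (χ y * β y * c ^ s)
      rw [mul_assoc (χ y * β y)] at h5
      convert! h5 using 2
      ring

/-- Off the support of `χ` the power may be discontinuous, as `g` need not be positive, but the
product vanishes near such points. -/
lemma continuous_mul_rpow {χ : EuclideanSpace ℝ (Fin n) → ℝ} (hχ : Continuous χ)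
    (hg : Continuous g) (s : ℝ) (hpos : ∀ y ∈ tsupport χ, 0 < g y) :
    Continuous fun y => χ y * g y ^ s := by
  refine continuous_iff_continuousAt.2 fun y => ?_
  by_cases hy : y ∈ tsupport χ
  · exact hχ.continuousAt.mul (hg.continuousAt.rpow_const (Or.inl (hpos y hy).ne'))
  · have h1 : (fun y => χ y * g y ^ s) =ᶠ[𝓝 y] fun _ => 0 := by
      filter_upwards [(isClosed_tsupport χ).isOpen_compl.mem_nhds hy] with z hz
      simp [image_eq_zero_of_notMem_tsupport hz]
    exact continuousAt_const.congr h1.symm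

/-- Powers of positive Sobolev functions are locally Sobolev functions. -/
lemma IsSobolev.cutoff_mul_rpow (hk : (n : ℝ) / 2 < k) (hg : IsSobolev k g) (s : ℝ)
    {χ : EuclideanSpace ℝ (Fin n) → ℝ} (hχ : ContDiff ℝ ∞ χ) (hχs : HasCompactSupport χ)
    (hpos : ∀ y ∈ tsupport χ, 0 < g y) : IsSobolev k fun y => χ y * g y ^ s := by
  choose! b hb hb1 hbS using fun (x : EuclideanSpace ℝ (Fin n)) (hx : 0 < g x) =>
    exists_cutoff_sobolevNorm_rpow_lt_top hk hg s hx
  -- Instead of a partition of unity, split `χ = χ b + χ (1 - b)` for one centre at a time. The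
  -- condition on the product says that nothing of `χ` is left once all centres of `t` are used.
  have main : ∀ t : Finset (EuclideanSpace ℝ (Fin n)), (∀ x ∈ t, 0 < g x) →
      ∀ χ : EuclideanSpace ℝ (Fin n) → ℝ, ContDiff ℝ ∞ χ → HasCompactSupport χ →
      (∀ y ∈ tsupport χ, 0 < g y) → (∀ y, χ y * ∏ x ∈ t, (1 - b x y) = 0) →
      IsSobolev k fun y => χ y * g y ^ s := by
    intro t
    induction t using Finset.induction_on with
    | empty =>
      intro _ χ hχ hχs _ h0
      have : χ = fun _ => 0 := by ext y; simpa using h0 y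
      have h1 := IsSobolev.of_contDiff k hχ hχs
      simp only [this, zero_mul] at h1 ⊢
      exact h1
    | insert x t hxt ih =>
      intro hpt χ hχ hχs hpos h0
      have hbx := hb x (hpt x (Finset.mem_insert_self x t))
      have hs1 : tsupport (fun y => χ y * b x y) ⊆ tsupport χ := tsupport_mul_subset_left
      have hs2 : tsupport (fun y => χ y * (1 - b x y)) ⊆ tsupport χ := tsupport_mul_subset_left
      have h1 : IsSobolev k fun y => χ y * b x y * g y ^ s :=
        ⟨continuous_mul_rpow (hχ.mul hbx).continuous hg.1 s fun y hy => hpos y (hs1 hy),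
          (hχs.mul_right (f' := b x)).mul_right,
          hbS x (hpt x (Finset.mem_insert_self x t)) χ hχ hχs⟩
      have h2 : IsSobolev k fun y => χ y * (1 - b x y) * g y ^ s :=
        ih (fun z hz => hpt z (Finset.mem_insert_of_mem hz)) _
          (hχ.mul (contDiff_const.sub hbx)) hχs.mul_right (fun y hy => hpos y (hs2 hy))
          fun y => by
            have := h0 y
            rw [Finset.prod_insert hxt] at this
            rw [← this]; ring
      convert! h1.add h2 using 2
      ring
  obtain ⟨t, ht, hcov⟩ := hχs.isCompact.elim_nhds_subcover (fun x => {y | b x y = 1})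
    fun x hx => hb1 x (hpos x hx)
  refine main t (fun x hx => hpos x (ht x hx)) χ hχ hχs hpos fun y => ?_
  by_cases hy : y ∈ tsupport χ
  · obtain ⟨x, hx, hxy⟩ := mem_iUnion₂.1 (hcov hy)
    rw [Finset.prod_eq_zero hx, mul_zero]
    have hxy : b x y = 1 := hxy
    rw [hxy, sub_self]
  · rw [image_eq_zero_of_notMem_tsupport hy, zero_mul]

end Localization

/-! ### Admissibility of `H^k(M)` and `C^∞(M)` -/

section Admissible

/-- The properties of a function space that are used to solve the geodesic equation in it. -/
structure FunctionSpace.IsAdmissible {M : Type u} [TopologicalSpace M] (X : FunctionSpace M) :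
    Prop where
  continuous : ∀ {f}, X.Mem f → Continuous f
  const_mem : ∀ c : ℝ, X.Mem fun _ => c
  add_mem : ∀ {f g}, X.Mem f → X.Mem g → X.Mem fun x => f x + g x
  mul_mem : ∀ {f g}, X.Mem f → X.Mem g → X.Mem fun x => f x * g x
  rpow_mem : ∀ {f} (s : ℝ), X.Mem f → (∀ x, 0 < f x) → X.Mem fun x => f x ^ s
  enorm_apply_le : ∀ x, ∃ (i : X.Index) (C : ℝ≥0∞), C ≠ ⊤ ∧ ∀ f : M → ℝ, Continuous f →
    ‖f x‖ₑ ≤ C * X.seminorm i f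
  tendsto_remainder : ∀ (i : X.Index) {W ρ} (s : ℝ), X.Mem W → X.Mem ρ →
    Tendsto (fun h : ℝ => X.seminorm i
      fun x => h⁻¹ * (W x * ((1 + h * ρ x) ^ s - 1 - s * (h * ρ x)))) (𝓝[≠] 0) (𝓝 0)

variable {n : ℕ} {M : Type u} [TopologicalSpace M] [ChartedSpace (EuclideanSpace ℝ (Fin n)) M]

lemma exists_contDiff_one_on_compact {K U : Set (EuclideanSpace ℝ (Fin n))} (hK : IsCompact K)
    (hU : IsOpen U) (hKU : K ⊆ U) : ∃ ψ : EuclideanSpace ℝ (Fin n) → ℝ, ContDiff ℝ ∞ ψ ∧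
      HasCompactSupport ψ ∧ tsupport ψ ⊆ U ∧ ∀ y ∈ K, ψ y = 1 := by
  obtain ⟨K', hK', hKK', hK'U⟩ := exists_compact_between hK hU hKU
  obtain ⟨f, hf1, hf0, -⟩ := exists_contMDiffMap_one_nhds_of_subset_interior
    (n := ⊤) 𝓘(ℝ, EuclideanSpace ℝ (Fin n)) hK.isClosed hKK'
  have hsub : tsupport f ⊆ K' := closure_minimal
    (fun y hy => by by_contra h; exact hy (hf0 y h)) hK'.isClosed
  exact ⟨f, f.contMDiff.contDiff, hK'.of_isClosed_subset (isClosed_tsupport _) hsub,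
    hsub.trans hK'U, fun y hy => hf1.self_of_nhdsSet y hy⟩

namespace ChartCutoff

/-- There is a larger cut-off function in the same chart. -/
lemma exists_larger (c : ChartCutoff n M) : ∃ c' : ChartCutoff n M, c'.chart = c.chart ∧
    ∀ y ∈ tsupport c.cutoff, c'.cutoff y = 1 := by
  obtain ⟨ψ, h1, h2, h3, h4⟩ := exists_contDiff_one_on_compact c.cutoff_compact.isCompact
    c.chart.open_target c.cutoff_support
  exact ⟨⟨c.chart, c.chart_mem, ψ, h1, h2, h3⟩, rfl, h4⟩

lemma exists_eq_one [IsManifold (𝓡 n) ∞ M] (x : M) : ∃ c : ChartCutoff n M,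
    x ∈ c.chart.source ∧ ∀ᶠ y in 𝓝 (c.chart x), c.cutoff y = 1 := by
  set e := chartAt (EuclideanSpace ℝ (Fin n)) x
  have hx : e x ∈ e.target := e.map_source (mem_chart_source _ x)
  obtain ⟨K, hK, hxK, hKt⟩ := exists_compact_subset e.open_target hx
  obtain ⟨ψ, h1, h2, h3, h4⟩ := exists_contDiff_one_on_compact hK e.open_target hKt
  refine ⟨⟨e, IsManifold.chart_mem_maximalAtlas x, ψ, h1, h2, h3⟩, mem_chart_source _ x, ?_⟩
  filter_upwards [mem_interior_iff_mem_nhds.1 hxK] with y hy using h4 y hy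

end ChartCutoff

variable {c c' : ChartCutoff n M} {f : M → ℝ}

lemma hasCompactSupport_localize (c : ChartCutoff n M) (f : M → ℝ) :
    HasCompactSupport (localize c f) :=
  c.cutoff_compact.mul_right

lemma localize_eventuallyEq_zero {y : EuclideanSpace ℝ (Fin n)} (hy : y ∉ tsupport c.cutoff) :
    localize c f =ᶠ[𝓝 y] fun _ => 0 := by
  filter_upwards [(isClosed_tsupport c.cutoff).isOpen_compl.mem_nhds hy] with z hz
  simp [localize, image_eq_zero_of_notMem_tsupport hz]

lemma continuous_localize (c : ChartCutoff n M) (hf : Continuous f) :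
    Continuous (localize c f) := by
  refine continuous_iff_continuousAt.2 fun y => ?_
  by_cases hy : y ∈ tsupport c.cutoff
  · exact c.cutoff_smooth.continuous.continuousAt.mul
      (hf.continuousAt.comp (c.chart.continuousAt_symm (c.cutoff_support hy)))
  · exact continuousAt_const.congr (localize_eventuallyEq_zero hy).symm

lemma contDiff_localize (c : ChartCutoff n M) (hf : ContMDiff (𝓡 n) 𝓘(ℝ, ℝ) ∞ f) :
    ContDiff ℝ ∞ (localize c f) := by
  refine contDiff_iff_contDiffAt.2 fun y => ?_
  by_cases hy : y ∈ tsupport c.cutoff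
  · have h1 : ContMDiffAt (𝓡 n) (𝓡 n) ∞ c.chart.symm y :=
      contMDiffAt_symm_of_mem_maximalAtlas c.chart_mem (c.cutoff_support hy)
    have h2 : ContMDiffAt (𝓡 n) 𝓘(ℝ, ℝ) ∞ (f ∘ c.chart.symm) y := hf.contMDiffAt.comp y h1
    exact c.cutoff_smooth.contDiffAt.mul h2.contDiffAt
  · exact contDiffAt_const.congr_of_eventuallyEq (localize_eventuallyEq_zero hy)

/-- In a nonlinear expression the cut-off `c` may multiply only one factor; the other factors are
localized with the larger `c'`, which is invisible where `c` is nonzero. -/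
lemma localize_of_eq_one (hc : c'.chart = c.chart) (h1 : ∀ y ∈ tsupport c.cutoff, c'.cutoff y = 1)
    {y : EuclideanSpace ℝ (Fin n)} (hy : c.cutoff y ≠ 0) :
    localize c' f y = f (c.chart.symm y) := by
  rw [localize, h1 y (subset_tsupport _ hy), one_mul, hc]

section Sobolev

variable {k : ℝ}

lemma isSobolev_localize (hf : (sobolevSpace n M k).Mem f) (c : ChartCutoff n M) :
    IsSobolev k (localize c f) :=
  ⟨continuous_localize c hf.1, hasCompactSupport_localize c f, hf.2 c⟩

lemma localize_apply_eq (c : ChartCutoff n M) (f : M → ℝ) {x : M} (hx : x ∈ c.chart.source)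
    (h1 : c.cutoff (c.chart x) = 1) : localize c f (c.chart x) = f x := by
  rw [localize, h1, c.chart.left_inv hx, one_mul]

lemma localize_remainder (hc : c'.chart = c.chart)
    (h1 : ∀ y ∈ tsupport c.cutoff, c'.cutoff y = 1) (W ρ : M → ℝ) (s h : ℝ) :
    localize c (fun x => h⁻¹ * (W x * ((1 + h * ρ x) ^ s - 1 - s * (h * ρ x)))) =
      fun y => h⁻¹ * (localize c W y *
        ((1 + h * localize c' ρ y) ^ s - 1 - s * (h * localize c' ρ y))) := by
  ext y
  by_cases hy : c.cutoff y = 0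
  · simp [localize, hy]
  · rw [localize_of_eq_one hc h1 hy]
    simp only [localize]
    ring

/-- For `k > n / 2` the Sobolev space `H^k(M)` is admissible. -/
lemma isAdmissible_sobolevSpace [IsManifold (𝓡 n) ∞ M] (hk : (n : ℝ) / 2 < k) :
    (sobolevSpace n M k).IsAdmissible where
  continuous hf := hf.1
  const_mem a := by
    refine ⟨continuous_const, fun c => ?_⟩
    exact sobolevNorm_lt_top_of_contDiff k (contDiff_localize c contMDiff_const)
      (hasCompactSupport_localize c _)
  add_mem {f g} hf hg := by
    refine ⟨hf.1.add hg.1, fun c => ?_⟩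
    have h := ((isSobolev_localize hf c).add (isSobolev_localize hg c)).3
    convert! h using 2
    ext y
    simp only [localize]
    ring
  mul_mem {f g} hf hg := by
    refine ⟨hf.1.mul hg.1, fun c => ?_⟩
    obtain ⟨c', hc, h1⟩ := c.exists_larger
    have h := ((isSobolev_localize hf c).mul hk (isSobolev_localize hg c')).3
    convert! h using 2
    ext y
    by_cases hy : c.cutoff y = 0
    · simp [localize, hy]
    · rw [localize_of_eq_one hc h1 hy]
      simp only [localize]
      ring
  rpow_mem {f} s hf hpos := by
    refine ⟨hf.1.rpow_const fun x => Or.inl (hpos x).ne', fun c => ?_⟩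
    obtain ⟨c', hc, h1⟩ := c.exists_larger
    have h := ((isSobolev_localize hf c').cutoff_mul_rpow hk s c.cutoff_smooth c.cutoff_compact
      fun y hy => by rw [localize, h1 y hy, one_mul]; exact hpos _).3
    convert! h using 2
    ext y
    by_cases hy : c.cutoff y = 0
    · simp [localize, hy]
    · rw [localize_of_eq_one hc h1 hy]
      rfl
  enorm_apply_le x := by
    obtain ⟨c, hx, h1⟩ := ChartCutoff.exists_eq_one (n := n) x
    obtain ⟨C, hC, hCg⟩ := exists_wienerNorm_le_sobolevNorm (n := n) k hk
    refine ⟨c, C, hC, fun f hf => ?_⟩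
    rw [← localize_apply_eq c f hx h1.self_of_nhds]
    exact (enorm_le_wienerNorm (continuous_localize c hf) (hasCompactSupport_localize c f) _).trans
      (hCg _ (continuous_localize c hf) (hasCompactSupport_localize c f))
  tendsto_remainder c W ρ s hW hρ := by
    obtain ⟨c', hc, h1⟩ := ChartCutoff.exists_larger c
    have h := tendsto_sobolevNorm_rpow_remainder hk (isSobolev_localize hW c)
      (isSobolev_localize hρ c') s
    simp only [← localize_remainder hc h1] at h
    exact h

end Sobolev

section Smooth

lemma sobolevSpace_mem_of_smooth (k : ℝ) (hf : (smoothSpace n M).Mem f) :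
    (sobolevSpace n M k).Mem f :=
  ⟨ContMDiff.continuous hf, fun c => sobolevNorm_lt_top_of_contDiff k (contDiff_localize c hf)
    (hasCompactSupport_localize c f)⟩

lemma exists_bound_of_continuous [CompactSpace M] (hf : Continuous f) : ∃ B, 0 < B ∧
    ∀ x, |f x| ≤ B := by
  obtain ⟨B, hB⟩ := isCompact_univ.exists_bound_of_continuousOn hf.continuousOn
  exact ⟨max B 1, by positivity, fun x => (hB x (mem_univ x)).trans (le_max_left _ _)⟩

/-- The space of smooth functions is admissible. -/
lemma isAdmissible_smoothSpace [IsManifold (𝓡 n) ∞ M] [CompactSpace M] :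
    (smoothSpace n M).IsAdmissible where
  continuous hf := ContMDiff.continuous hf
  const_mem a := contMDiff_const
  add_mem hf hg := ContMDiff.add hf hg
  mul_mem hf hg := ContMDiff.mul hf hg
  rpow_mem {f} s hf hpos x :=
    ((Real.contDiffAt_rpow_const_of_ne (hpos x).ne').contMDiffAt).comp x (hf x)
  enorm_apply_le x := by
    obtain ⟨c, hx, h1⟩ := ChartCutoff.exists_eq_one (n := n) x
    refine ⟨(c, 0), 1, by simp, fun f hf => ?_⟩
    rw [← localize_apply_eq c f hx h1.self_of_nhds, one_mul]
    refine le_trans (le_of_eq ?_)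
      (le_iSup (fun y => ‖iteratedFDeriv ℝ 0 (localize c f) y‖ₑ) (c.chart x))
    rw [enorm_eq_iff_norm_eq, norm_iteratedFDeriv_zero]
  tendsto_remainder i W ρ s hW hρ := by
    obtain ⟨c, j⟩ := i
    have hk : (n : ℝ) / 2 + j < (n : ℝ) / 2 + j + 1 := by linarith
    have hk' : (n : ℝ) / 2 < (n : ℝ) / 2 + j + 1 := by
      have : (0 : ℝ) ≤ j := by positivity
      linarith
    obtain ⟨C, hC, hCg⟩ := exists_iSup_iteratedFDeriv_le_sobolevNorm (n := n) j hk
    have h1 := (isAdmissible_sobolevSpace (n := n) (M := M) hk').tendsto_remainder c s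
      (sobolevSpace_mem_of_smooth _ hW) (sobolevSpace_mem_of_smooth _ hρ)
    have h2 := ENNReal.Tendsto.const_mul h1 (Or.inr hC)
    rw [mul_zero] at h2
    obtain ⟨B, hB0, hB⟩ := exists_bound_of_continuous (ContMDiff.continuous hρ)
    -- This keeps `1 + h ρ` positive, so that the remainder is continuous and the derivative bound
    -- applies to its localization.
    have hsmall : ∀ᶠ h : ℝ in 𝓝[≠] 0, |h| * B < 1 := by
      have : ContinuousAt (fun h : ℝ => |h| * B) 0 := by fun_prop
      exact nhdsWithin_le_nhds (this.eventually_lt_const (by simp))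
    refine tendsto_of_tendsto_of_tendsto_of_le_of_le' tendsto_const_nhds h2
      (Eventually.of_forall fun _ => zero_le) ?_
    filter_upwards [hsmall] with h hh
    have hpos : ∀ x, 0 < 1 + h * ρ x := fun x => by
      have h3 : |h * ρ x| < 1 := by
        rw [abs_mul]
        exact lt_of_le_of_lt (mul_le_mul_of_nonneg_left (hB x) (abs_nonneg _)) hh
      linarith [(abs_lt.1 h3).1]
    have hρc : Continuous ρ := ContMDiff.continuous hρ
    have hWc : Continuous W := ContMDiff.continuous hW
    have hcont : Continuous fun x => h⁻¹ * (W x * ((1 + h * ρ x) ^ s - 1 - s * (h * ρ x))) := by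
      have h4 : Continuous fun x => (1 + h * ρ x) ^ s :=
        Continuous.rpow_const (by fun_prop) fun x => Or.inl (hpos x).ne'
      fun_prop
    exact hCg _ (continuous_localize c hcont) (hasCompactSupport_localize c _)

end Smooth

end Admissible

/-! ### Explicit solution, uniqueness and maximal existence time -/

section Solutions

lemma one_div_pStar {α : ℝ} : 1 / pStar α = 1 - 1 / pExp α := by
  rw [pStar, pExp, one_div_div, one_div_div]; ring

lemma pExp_pos {α : ℝ} (hα : α ∈ Ioo (-1 : ℝ) 1) : 0 < pExp α := by
  have := hα.2
  exact div_pos two_pos (by linarith)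

lemma convex_timeInterval (T : ℝ≥0∞) : Convex ℝ (timeInterval T) := by
  refine OrdConnected.convex ⟨fun a ha b hb c hc => ⟨ha.1.trans hc.1, ?_⟩⟩
  exact (ENNReal.ofReal_le_ofReal hc.2).trans_lt hb.2

variable {M : Type u} [TopologicalSpace M]

/-- The time up to which `1 + t q` stays positive. -/
lemma exists_positivity_time [CompactSpace M] {q : M → ℝ} (hq : Continuous q) :
    ∃ T : ℝ≥0∞, 0 < T ∧ ∀ t : ℝ, 0 ≤ t → (ENNReal.ofReal t < T ↔ ∀ x, 0 < 1 + t * q x) := by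
  by_cases h : ∀ x, 0 ≤ q x
  · refine ⟨⊤, by simp, fun t ht => ⟨fun _ x => ?_, fun _ => ENNReal.ofReal_lt_top⟩⟩
    have := mul_nonneg ht (h x)
    linarith
  · push Not at h
    obtain ⟨x₁, hx₁⟩ := h
    obtain ⟨x₀, -, hmin⟩ := isCompact_univ.exists_isMinOn ⟨x₁, mem_univ x₁⟩ hq.continuousOn
    have hm : q x₀ < 0 := (hmin (mem_univ x₁)).trans_lt hx₁
    -- The factor `1 + t q` first vanishes where `q` is most negative.
    refine ⟨ENNReal.ofReal (-q x₀)⁻¹, ?_, fun t ht => ?_⟩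
    · rw [ENNReal.ofReal_pos]; exact inv_pos.2 (by linarith)
    · rw [ENNReal.ofReal_lt_ofReal_iff (inv_pos.2 (by linarith)), ← one_div,
        lt_div_iff₀ (by linarith)]
      refine ⟨fun h1 x => ?_, fun h1 => ?_⟩
      · have h2 : q x₀ ≤ q x := hmin (mem_univ x)
        nlinarith
      · have := h1 x₀
        nlinarith
variable {X : FunctionSpace M}

/-- Convergence in an admissible space implies pointwise convergence. -/
lemma FunctionSpace.HasTimeDeriv.hasDerivWithinAt (hX : X.IsAdmissible) {γ : ℝ → M → ℝ}
    {w : M → ℝ} {J : Set ℝ} {t : ℝ} (h : X.HasTimeDeriv γ w J t)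
    (hγ : ∀ s ∈ J, Continuous (γ s)) (ht : t ∈ J) (hw : Continuous w) (x : M) :
    HasDerivWithinAt (fun s => γ s x) (w x) J t := by
  rw [hasDerivWithinAt_iff_tendsto_slope, tendsto_iff_edist_tendsto_0]
  obtain ⟨i, C, hC, hCf⟩ := hX.enorm_apply_le x
  have h1 := ENNReal.Tendsto.const_mul (h i) (Or.inr hC)
  rw [mul_zero] at h1
  refine tendsto_of_tendsto_of_tendsto_of_le_of_le' tendsto_const_nhds h1
    (Eventually.of_forall fun _ => zero_le) ?_
  filter_upwards [self_mem_nhdsWithin] with s hs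
  have h2 := hCf (fun x => (s - t)⁻¹ * (γ s x - γ t x) - w x)
    ((continuous_const.mul ((hγ s hs.1).sub (hγ t ht))).sub hw)
  rwa [edist_eq_enorm_sub]

/-- The curve `t ↦ W (1 + t q)^σ` is differentiable in every admissible space. -/
lemma FunctionSpace.IsAdmissible.hasTimeDeriv_rpow (hX : X.IsAdmissible) {W q : M → ℝ}
    (hW : X.Mem W) (hq : X.Mem q) (σ : ℝ) {J : Set ℝ} (hJ : ∀ s ∈ J, ∀ x, 0 < 1 + s * q x)
    {t : ℝ} (ht : t ∈ J) :
    X.HasTimeDeriv (fun s x => W x * (1 + s * q x) ^ σ)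
      (fun x => W x * (σ * q x * (1 + t * q x) ^ (σ - 1))) J t := by
  have hb : X.Mem fun x => 1 + t * q x := hX.add_mem (hX.const_mem 1) (hX.mul_mem (hX.const_mem t) hq)
  have hρ : X.Mem fun x => q x * (1 + t * q x) ^ (-1 : ℝ) :=
    hX.mul_mem hq (hX.rpow_mem _ hb (hJ t ht))
  have hW' : X.Mem fun x => W x * (1 + t * q x) ^ σ := hX.mul_mem hW (hX.rpow_mem _ hb (hJ t ht))
  intro i
  have h1 := hX.tendsto_remainder i σ hW' hρ
  have h2 : Tendsto (fun s => s - t) (𝓝[J \ {t}] t) (𝓝[≠] 0) := by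
    refine tendsto_nhdsWithin_iff.2 ⟨?_, ?_⟩
    · have : Continuous fun s : ℝ => s - t := by fun_prop
      simpa using (this.tendsto t).mono_left nhdsWithin_le_nhds
    · filter_upwards [self_mem_nhdsWithin] with s hs
      exact sub_ne_zero.2 hs.2
  refine (h1.comp h2).congr' ?_
  filter_upwards [self_mem_nhdsWithin] with s hs
  have hst : s - t ≠ 0 := sub_ne_zero.2 hs.2
  simp only [Function.comp_apply]
  congr 1
  ext x
  have hA := hJ t ht x
  have hB := hJ s hs.1 x
  -- Factoring out the value at time `t` reduces differentiability at `t` to the remainder estimate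
  -- at `0`, with step `s - t` and `ρ = q / (1 + t q)`.
  have e1 : 1 + s * q x = (1 + t * q x) * (1 + (s - t) * (q x * (1 + t * q x) ^ (-1 : ℝ))) := by
    have hA' := hA.ne'
    rw [Real.rpow_neg_one, mul_add, mul_one, mul_left_comm, mul_left_comm _ (q x),
      mul_inv_cancel₀ hA']
    ring
  have hR : 0 < 1 + (s - t) * (q x * (1 + t * q x) ^ (-1 : ℝ)) := by
    rw [e1] at hB
    exact pos_of_mul_pos_right hB hA.le
  rw [e1, Real.mul_rpow hA.le hR.le, Real.rpow_sub_one hA.ne', Real.rpow_neg_one]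
  field_simp

variable {α : ℝ}

/-- The explicit solution of the geodesic equation. -/
def geodesicFlow (α : ℝ) (μ₀ v₀ : M → ℝ) (t : ℝ) (x : M) : ℝ :=
  μ₀ x * (1 + t * (v₀ x / (pExp α * μ₀ x))) ^ pExp α

/-- With `q = v₀ / (p μ₀)` the velocity is `v₀ (1 + t q)^(p - 1)`, and the equation becomes an
identity because `1/p* = (p - 1)/p`. -/
lemma geodesicFlow_isSolution (hX : X.IsAdmissible) (hα : α ∈ Ioo (-1 : ℝ) 1) {μ₀ v₀ : M → ℝ}
    (hμ : X.IsDensity μ₀) (hv : X.Mem v₀) {T : ℝ≥0∞}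
    (hT : ∀ t ∈ timeInterval T, ∀ x, 0 < 1 + t * (v₀ x / (pExp α * μ₀ x))) :
    X.IsSolution α μ₀ v₀ T (geodesicFlow α μ₀ v₀) := by
  have hp := pExp_pos hα
  set p := pExp α
  set q : M → ℝ := fun x => v₀ x / (p * μ₀ x) with hqd
  have hμ0 := hμ.2
  have hq : X.Mem q := by
    have h1 := hX.mul_mem (hX.mul_mem (hX.const_mem p⁻¹) hv) (hX.rpow_mem (-1) hμ.1 hμ.2)
    convert! h1 using 2 with x
    have := (hμ0 x).ne'
    rw [Real.rpow_neg_one, hqd]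
    field_simp
  refine ⟨fun t x => v₀ x * (1 + t * q x) ^ (p - 1), ?_, ?_, fun t ht => ?_⟩
  · ext x; simp [geodesicFlow]
  · ext x; simp
  have hb : X.Mem fun x => 1 + t * q x :=
    hX.add_mem (hX.const_mem 1) (hX.mul_mem (hX.const_mem t) hq)
  have hacc : geodesicAcc α (geodesicFlow α μ₀ v₀ t) (fun x => v₀ x * (1 + t * q x) ^ (p - 1)) =
      fun x => v₀ x * ((p - 1) * q x * (1 + t * q x) ^ (p - 1 - 1)) := by
    ext x
    have h0 := hμ0 x
    have hA : 0 < 1 + t * q x := hT t ht x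
    have hAp : 0 < (1 + t * q x) ^ p := Real.rpow_pos_of_pos hA p
    have e1 : q x = v₀ x / (p * μ₀ x) := rfl
    simp only [geodesicAcc, geodesicFlow]
    change 1 / pStar α * (v₀ x * (1 + t * q x) ^ (p - 1) / (μ₀ x * (1 + t * q x) ^ p)) *
      (v₀ x * (1 + t * q x) ^ (p - 1)) = _
    rw [one_div_pStar, Real.rpow_sub_one hA.ne' (p - 1), Real.rpow_sub_one hA.ne' p]
    change (1 - 1 / p) * _ * _ = _
    set A := 1 + t * q x
    rw [e1]
    field_simp
  refine ⟨⟨?_, fun x => mul_pos (hμ0 x) (Real.rpow_pos_of_pos (hT t ht x) _)⟩, ?_, ?_, ?_, ?_⟩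
  · exact hX.mul_mem hμ.1 (hX.rpow_mem p hb (hT t ht))
  · exact hX.mul_mem hv (hX.rpow_mem _ hb (hT t ht))
  · beta_reduce
    rw [hacc]
    exact hX.mul_mem hv (hX.mul_mem (hX.mul_mem (hX.const_mem _) hq) (hX.rpow_mem _ hb (hT t ht)))
  · have h1 := hX.hasTimeDeriv_rpow hμ.1 hq p hT ht
    convert! h1 using 2
    rename_i x
    have := (hμ0 x).ne'
    simp only [hqd]
    field_simp
  · beta_reduce
    rw [hacc]
    exact hX.hasTimeDeriv_rpow hv hq (p - 1) hT ht

lemma eq_of_hasDerivWithinAt_zero {J : Set ℝ} (hJ : Convex ℝ J) {f : ℝ → ℝ}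
    (hf : ∀ t ∈ J, HasDerivWithinAt f 0 J t) {s t : ℝ} (hs : s ∈ J) (ht : t ∈ J) : f t = f s := by
  have h := hJ.norm_image_sub_le_of_norm_hasDerivWithin_le (C := 0) hf (by simp) hs ht
  rw [zero_mul, norm_le_zero_iff, sub_eq_zero] at h
  exact h

/-- The `1/p`-th power of a solution is affine in time. -/
lemma scalar_geodesic_eq {p : ℝ} (hp : 0 < p) {J : Set ℝ} (hJ : Convex ℝ J) (h0 : (0 : ℝ) ∈ J)
    {g v : ℝ → ℝ} (hpos : ∀ t ∈ J, 0 < g t) (hg : ∀ t ∈ J, HasDerivWithinAt g (v t) J t)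
    (hv : ∀ t ∈ J, HasDerivWithinAt v ((1 - 1 / p) * (v t / g t) * v t) J t) {t : ℝ}
    (ht : t ∈ J) : 0 < 1 + t * (v 0 / (p * g 0)) ∧ g t = g 0 * (1 + t * (v 0 / (p * g 0))) ^ p := by
  -- `z` is the derivative of `g^(1/p)`; the equation for `v` says that `z` is constant.
  set z : ℝ → ℝ := fun s => 1 / p * g s ^ (1 / p - 1) * v s with hz
  have hu : ∀ s ∈ J, HasDerivWithinAt (fun s => g s ^ (1 / p)) (z s) J s := fun s hs => by
    refine ((hg s hs).rpow_const (p := 1 / p) (Or.inl (hpos s hs).ne')).congr_deriv ?_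
    simp only [hz]; ring
  have hz' : ∀ s ∈ J, HasDerivWithinAt z 0 J s := fun s hs => by
    have h1 := (((hg s hs).rpow_const (p := 1 / p - 1) (Or.inl (hpos s hs).ne')).const_mul
      (1 / p)).mul (hv s hs)
    refine h1.congr_deriv ?_
    have := hpos s hs
    rw [Real.rpow_sub_one this.ne' (1 / p - 1)]
    field_simp
    ring
  have hzc : ∀ s ∈ J, z s = z 0 := fun s hs => eq_of_hasDerivWithinAt_zero hJ hz' h0 hs
  have haff : ∀ s ∈ J, HasDerivWithinAt (fun s => g s ^ (1 / p) - s * z 0) 0 J s := fun s hs => by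
    refine ((hu s hs).sub ((hasDerivWithinAt_id s J).mul_const (z 0))).congr_deriv ?_
    rw [hzc s hs]; ring
  have h1 := eq_of_hasDerivWithinAt_zero hJ haff h0 ht
  have hg0 := hpos 0 h0
  have hgt := hpos t ht
  have hu0 : 0 < g 0 ^ (1 / p) := Real.rpow_pos_of_pos hg0 _
  have hut : 0 < g t ^ (1 / p) := Real.rpow_pos_of_pos hgt _
  have e : g t ^ (1 / p) = g 0 ^ (1 / p) * (1 + t * (v 0 / (p * g 0))) := by
    simp only [hz] at h1
    rw [Real.rpow_sub_one hg0.ne'] at h1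
    have h2 : g t ^ (1 / p) = g 0 ^ (1 / p) + t * (1 / p * (g 0 ^ (1 / p) / g 0) * v 0) := by
      linarith
    rw [h2]
    field_simp
  -- Positivity of the solution itself forces positivity of the affine factor; this is what bounds
  -- the lifetime of every solution.
  have hA : 0 < 1 + t * (v 0 / (p * g 0)) := by
    rw [e] at hut
    exact pos_of_mul_pos_right hut hu0.le
  refine ⟨hA, ?_⟩
  have h3 : ∀ y : ℝ, 0 < y → (y ^ (1 / p)) ^ p = y := fun y hy => by
    rw [← Real.rpow_mul hy.le, one_div_mul_cancel hp.ne', Real.rpow_one]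
  rw [← h3 (g t) hgt, e, Real.mul_rpow hu0.le hA.le, h3 _ hg0]

/-- Convergence in an admissible space is pointwise, so at each `x` the scalar equation applies.
This yields uniqueness and the bound on the lifetime together. -/
lemma FunctionSpace.IsSolution.eq_geodesicFlow (hX : X.IsAdmissible) (hα : α ∈ Ioo (-1 : ℝ) 1)
    {μ₀ v₀ : M → ℝ} {T : ℝ≥0∞} {γ : ℝ → M → ℝ} (h : X.IsSolution α μ₀ v₀ T γ) {t : ℝ}
    (ht : t ∈ timeInterval T) (x : M) :
    0 < 1 + t * (v₀ x / (pExp α * μ₀ x)) ∧ γ t x = geodesicFlow α μ₀ v₀ t x := by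
  obtain ⟨v, rfl, rfl, hpath⟩ := h
  have h0 : (0 : ℝ) ∈ timeInterval T := ⟨le_rfl, by
    rw [ENNReal.ofReal_zero]; exact zero_le.trans_lt ht.2⟩
  refine scalar_geodesic_eq (g := fun s => γ s x) (v := fun s => v s x) (pExp_pos hα)
    (convex_timeInterval T) h0 (fun s hs => (hpath s hs).1.2 x) (fun s hs => ?_)
    (fun s hs => ?_) ht
  · exact (hpath s hs).2.2.2.1.hasDerivWithinAt hX
      (fun r hr => hX.continuous (hpath r hr).1.1) hs (hX.continuous (hpath s hs).2.1) x
  · rw [← one_div_pStar]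
    exact (hpath s hs).2.2.2.2.hasDerivWithinAt hX
      (fun r hr => hX.continuous (hpath r hr).2.1) hs (hX.continuous (hpath s hs).2.2.1) x

/-- Well-posedness in all admissible spaces, with the same maximal solution. -/
lemma exists_maximalSolution [CompactSpace M] (hα : α ∈ Ioo (-1 : ℝ) 1) (μ₀ v₀ : M → ℝ) :
    ∃ (T : ℝ≥0∞) (γ : ℝ → M → ℝ), 0 < T ∧ ∀ X : FunctionSpace M, X.IsAdmissible →
      X.IsDensity μ₀ → X.Mem v₀ → X.IsMaximalSolution α μ₀ v₀ T γ := by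
  by_cases hc : Continuous μ₀ ∧ (∀ x, 0 < μ₀ x) ∧ Continuous v₀
  · obtain ⟨hμ, hpos, hv⟩ := hc
    have hq : Continuous fun x => v₀ x / (pExp α * μ₀ x) :=
      hv.div (continuous_const.mul hμ) fun x => (mul_pos (pExp_pos hα) (hpos x)).ne'
    obtain ⟨T, hT0, hT⟩ := exists_positivity_time hq
    refine ⟨T, geodesicFlow α μ₀ v₀, hT0, fun X hX hμX hvX => ⟨?_, fun T' γ' h' => ⟨?_, ?_⟩⟩⟩
    · exact geodesicFlow_isSolution hX hα hμX hvX fun t ht => (hT t ht.1).1 ht.2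
    -- A solution living beyond `T` would exist at time `T` itself, so `1 + T q` would be positive
    -- everywhere, which means `T < T`.
    · by_contra hlt
      push Not at hlt
      have hTr : ENNReal.ofReal T.toReal = T := ENNReal.ofReal_toReal hlt.ne_top
      have hmem : T.toReal ∈ timeInterval T' := ⟨ENNReal.toReal_nonneg, by rwa [hTr]⟩
      have := (hT T.toReal ENNReal.toReal_nonneg).2 fun x => (h'.eq_geodesicFlow hX hα hmem x).1
      rw [hTr] at this
      exact lt_irrefl _ this
    · exact fun t ht => funext fun x => (h'.eq_geodesicFlow hX hα ht x).2
  -- Such data lie in no admissible space, so the values are arbitrary.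
  · exact ⟨1, fun _ _ => 0, one_pos, fun X hX hμX hvX =>
      absurd ⟨hX.continuous hμX.1, hμX.2, hX.continuous hvX⟩ hc⟩

end Solutions

/-! ### The smooth volume as a measure -/

section Volume

variable {n : ℕ} {M : Type u} [TopologicalSpace M] [ChartedSpace (EuclideanSpace ℝ (Fin n)) M]
  [IsManifold (𝓡 n) ∞ M] [MeasurableSpace M] [BorelSpace M] {lam : Measure M}

/-- A smooth volume in a chart. -/
lemma IsSmoothVolume.exists_density (hlam : IsSmoothVolume n lam) (x : M) :
    ∃ ρ : EuclideanSpace ℝ (Fin n) → ℝ, ContinuousOn ρ (chartAt (EuclideanSpace ℝ (Fin n)) x).target ∧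
      (∀ y ∈ (chartAt (EuclideanSpace ℝ (Fin n)) x).target, 0 < ρ y) ∧
      ∀ V : Set (EuclideanSpace ℝ (Fin n)), IsOpen V →
        lam ((chartAt (EuclideanSpace ℝ (Fin n)) x).source ∩
          chartAt (EuclideanSpace ℝ (Fin n)) x ⁻¹' V) =
        (volume.restrict (chartAt (EuclideanSpace ℝ (Fin n)) x).target).withDensity
          (fun y => ENNReal.ofReal (ρ y)) V := by
  set e := chartAt (EuclideanSpace ℝ (Fin n)) x
  obtain ⟨ρ, h1, h2, h3⟩ := hlam e (IsManifold.chart_mem_maximalAtlas x)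
  refine ⟨ρ, h1.continuousOn, h2, fun V hV => ?_⟩
  have hae : AEMeasurable e (lam.restrict e.source) :=
    e.continuousOn.aemeasurable e.open_source.measurableSet
  rw [← h3, Measure.map_apply_of_aemeasurable hae hV.measurableSet,
    Measure.restrict_apply' e.open_source.measurableSet, inter_comm]

/-- The chart density is bounded on compact neighbourhoods. On a compact `M` this makes `lam`
finite. -/
lemma IsSmoothVolume.isLocallyFiniteMeasure (hlam : IsSmoothVolume n lam) :
    IsLocallyFiniteMeasure lam := by
  refine ⟨fun x => ?_⟩
  obtain ⟨ρ, hρ, -, hV⟩ := hlam.exists_density x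
  set e := chartAt (EuclideanSpace ℝ (Fin n)) x
  obtain ⟨K, hK, hxK, hKt⟩ := exists_compact_subset e.open_target
    (e.map_source (mem_chart_source _ x))
  refine ⟨_, (e.isOpen_inter_preimage isOpen_interior).mem_nhds
    ⟨mem_chart_source _ x, hxK⟩, ?_⟩
  rw [hV _ isOpen_interior, withDensity_apply _ isOpen_interior.measurableSet]
  obtain ⟨B, hB⟩ := hK.exists_bound_of_continuousOn (hρ.mono hKt)
  refine lt_of_le_of_lt (setLIntegral_mono' (g := fun _ => ENNReal.ofReal B)
    isOpen_interior.measurableSet fun y hy => ?_) ?_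
  · exact ENNReal.ofReal_le_ofReal ((le_abs_self _).trans (hB y (interior_subset hy)))
  · rw [setLIntegral_const]
    refine ENNReal.mul_lt_top ENNReal.ofReal_lt_top ?_
    exact (Measure.restrict_apply_le _ _).trans_lt
      ((measure_mono interior_subset).trans_lt hK.measure_lt_top)

/-- The chart density is positive, so a null open set has Lebesgue null image in every chart. This
turns almost everywhere equality of continuous functions into equality. -/
lemma IsSmoothVolume.isOpenPosMeasure (hlam : IsSmoothVolume n lam) :
    lam.IsOpenPosMeasure := by
  refine ⟨fun U hU ⟨x, hx⟩ h0 => ?_⟩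
  obtain ⟨ρ, hρ, hpos, hV⟩ := hlam.exists_density x
  set e := chartAt (EuclideanSpace ℝ (Fin n)) x
  have hVo : IsOpen (e.target ∩ e.symm ⁻¹' U) := e.isOpen_inter_preimage_symm hU
  have hsub : e.source ∩ e ⁻¹' (e.target ∩ e.symm ⁻¹' U) ⊆ U := by
    rintro y ⟨hy, -, hyU⟩
    rwa [mem_preimage, e.left_inv hy] at hyU
  have h1 := (hV _ hVo).symm.trans (measure_mono_null hsub h0)
  rw [withDensity_apply_eq_zero' ((hρ.aemeasurable e.open_target.measurableSet).ennreal_ofReal)] at h1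
  have h2 : {y | ENNReal.ofReal (ρ y) ≠ 0} ∩ (e.target ∩ e.symm ⁻¹' U) =
      e.target ∩ e.symm ⁻¹' U := by
    refine inter_eq_right.2 fun y hy => ?_
    simpa using hpos y hy.1
  rw [h2, Measure.restrict_eq_self _ inter_subset_left] at h1
  refine (hVo.measure_pos volume ⟨e x, e.map_source (mem_chart_source _ x), ?_⟩).ne' h1
  rw [mem_preimage, e.left_inv (mem_chart_source _ x)]
  exact hx

end Volume

/-! ### Differentiation of integrals along curves of functions -/

section IntegralDerivative

/-- The curve `F` of functions is Lipschitz at `t`, uniformly on `M`. -/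
def UniformLipschitzAt {M : Type*} (F : ℝ → M → ℝ) (J : Set ℝ) (t : ℝ) : Prop :=
  ∃ L : ℝ, 0 ≤ L ∧ ∀ᶠ s in 𝓝[J] t, ∀ x, |F s x - F t x| ≤ L * |s - t|

variable {M : Type u} {F G : ℝ → M → ℝ} {J : Set ℝ} {t : ℝ}

lemma eventually_abs_sub_lt (t : ℝ) (J : Set ℝ) {δ : ℝ} (hδ : 0 < δ) :
    ∀ᶠ s in 𝓝[J] t, |s - t| < δ := by
  have : Continuous fun s : ℝ => |s - t| := by fun_prop
  exact nhdsWithin_le_nhds (this.continuousAt.eventually_lt_const (by simpa using hδ))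

lemma uniformLipschitzAt_const (f : M → ℝ) : UniformLipschitzAt (fun _ => f) J t :=
  ⟨0, le_rfl, Eventually.of_forall fun s x => by simp⟩

lemma UniformLipschitzAt.mul (hF : UniformLipschitzAt F J t) (hG : UniformLipschitzAt G J t)
    {A B : ℝ} (hFt : ∀ x, |F t x| ≤ A) (hGt : ∀ x, |G t x| ≤ B) :
    UniformLipschitzAt (fun s x => F s x * G s x) J t := by
  obtain ⟨L, hL0, hL⟩ := hF
  obtain ⟨K, hK0, hK⟩ := hG
  refine ⟨L * (|B| + K) + |A| * K, by positivity, ?_⟩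
  filter_upwards [hL, hK, eventually_abs_sub_lt t J one_pos] with s h1 h2 h3 x
  have e : F s x * G s x - F t x * G t x =
      (F s x - F t x) * G s x + F t x * (G s x - G t x) := by ring
  have hGs : |G s x| ≤ |B| + K := by
    have h4 : |G s x| ≤ |G t x| + |G s x - G t x| := by
      simpa using abs_add_le (G t x) (G s x - G t x)
    have h5 := (hGt x).trans (le_abs_self B)
    nlinarith [h2 x, abs_nonneg (s - t)]
  rw [e]
  refine (abs_add_le _ _).trans ?_
  rw [abs_mul, abs_mul]
  have h6 : |F s x - F t x| * |G s x| ≤ L * |s - t| * (|B| + K) :=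
    mul_le_mul (h1 x) hGs (abs_nonneg _) (by positivity)
  have h7 : |F t x| * |G s x - G t x| ≤ |A| * (K * |s - t|) :=
    mul_le_mul ((hFt x).trans (le_abs_self A)) (h2 x) (abs_nonneg _) (abs_nonneg _)
  linarith

lemma UniformLipschitzAt.eventually_mem_Icc (hF : UniformLipschitzAt F J t) {m B : ℝ} (hm : 0 < m)
    (hFt : ∀ x, F t x ∈ Icc m B) : ∀ᶠ s in 𝓝[J] t, ∀ x, F s x ∈ Icc (m / 2) (B + m / 2) := by
  obtain ⟨L, hL0, hL⟩ := hF
  filter_upwards [hL, eventually_abs_sub_lt t J (δ := m / (2 * (L + 1))) (by positivity)]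
    with s h1 h2 x
  have h3 : L * |s - t| ≤ m / 2 := by
    rw [lt_div_iff₀ (by positivity)] at h2
    nlinarith [abs_nonneg (s - t)]
  have h4 := abs_le.1 ((h1 x).trans h3)
  have h5 := hFt x
  exact ⟨by linarith [h5.1], by linarith [h5.2]⟩

/-- Near time `t` all values stay in a compact interval of positive numbers, on which `y ↦ y^β` is
Lipschitz. -/
lemma UniformLipschitzAt.rpow (hF : UniformLipschitzAt F J t) (β : ℝ) {m B : ℝ} (hm : 0 < m)
    (hFt : ∀ x, F t x ∈ Icc m B) : UniformLipschitzAt (fun s x => F s x ^ β) J t := by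
  have hev := hF.eventually_mem_Icc hm hFt
  obtain ⟨L, hL0, hL⟩ := hF
  have hcd : ContDiffOn ℝ 1 (fun y : ℝ => y ^ β) (Icc (m / 2) (B + m / 2)) := fun y hy =>
    (Real.contDiffAt_rpow_const_of_ne (by linarith [hy.1] : 0 < y).ne').contDiffWithinAt
  obtain ⟨K, hK⟩ := hcd.exists_lipschitzOnWith one_ne_zero (convex_Icc _ _) isCompact_Icc
  refine ⟨K * L, by positivity, ?_⟩
  filter_upwards [hL, hev] with s h1 h2 x
  have h3 : F t x ∈ Icc (m / 2) (B + m / 2) :=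
    ⟨by linarith [(hFt x).1], by linarith [(hFt x).2]⟩
  have h4 := hK.dist_le_mul _ (h2 x) _ h3
  rw [Real.dist_eq, Real.dist_eq] at h4
  refine h4.trans ?_
  rw [mul_assoc]
  exact mul_le_mul_of_nonneg_left (h1 x) K.2

variable [TopologicalSpace M] [CompactSpace M]

lemma exists_mem_Icc_of_continuous_pos {f : M → ℝ} (hf : Continuous f) (hpos : ∀ x, 0 < f x) :
    ∃ m B : ℝ, 0 < m ∧ ∀ x, f x ∈ Icc m B := by
  obtain ⟨B, -, hB⟩ := exists_bound_of_continuous hf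
  rcases isEmpty_or_nonempty M with h | ⟨⟨x₁⟩⟩
  · exact ⟨1, 1, one_pos, fun x => h.elim x⟩
  obtain ⟨x₀, -, hmin⟩ := isCompact_univ.exists_isMinOn ⟨x₁, mem_univ x₁⟩ hf.continuousOn
  exact ⟨f x₀, B, hpos x₀, fun x => ⟨hmin (mem_univ x), (le_abs_self _).trans (hB x)⟩⟩

lemma uniformLipschitzAt_add_mul {f b : M → ℝ} (hb : Continuous b) :
    UniformLipschitzAt (fun s x => f x + s * b x) univ t := by
  obtain ⟨B, hB0, hB⟩ := exists_bound_of_continuous hb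
  refine ⟨B, hB0.le, Eventually.of_forall fun s x => ?_⟩
  have : f x + s * b x - (f x + t * b x) = b x * (s - t) := by ring
  rw [this, abs_mul]
  exact mul_le_mul_of_nonneg_right (hB x) (abs_nonneg _)

variable [MeasurableSpace M] [BorelSpace M] {lam : Measure M} [IsFiniteMeasure lam]

lemma integrable_of_continuous {f : M → ℝ} (hf : Continuous f) : Integrable f lam :=
  hf.integrable_of_hasCompactSupport (HasCompactSupport.of_compactSpace f)

/-- Differentiation under the integral sign. -/
lemma hasDerivWithinAt_integral_of_uniformLipschitzAt (ht : t ∈ J)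
    (hF : UniformLipschitzAt F J t) (hc : ∀ᶠ s in 𝓝[J] t, Continuous (F s)) {F' : M → ℝ}
    (hd : ∀ x, HasDerivWithinAt (fun s => F s x) (F' x) J t) :
    HasDerivWithinAt (fun s => ∫ x, F s x ∂lam) (∫ x, F' x ∂lam) J t := by
  obtain ⟨L, hL0, hL⟩ := hF
  have hct : Continuous (F t) := hc.self_of_nhdsWithin ht
  rw [hasDerivWithinAt_iff_tendsto_slope]
  have hle : 𝓝[J \ {t}] t ≤ 𝓝[J] t := nhdsWithin_mono _ sdiff_subset
  have h1 : Tendsto (fun s => ∫ x, (s - t)⁻¹ * (F s x - F t x) ∂lam) (𝓝[J \ {t}] t)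
      (𝓝 (∫ x, F' x ∂lam)) := by
    -- The Lipschitz constant dominates all difference quotients, and is integrable because `lam` is
    -- finite.
    refine tendsto_integral_filter_of_dominated_convergence (fun _ => L) ?_ ?_
      (integrable_const L) (Eventually.of_forall fun x => ?_)
    · filter_upwards [hle hc] with s hs
      exact (continuous_const.mul (hs.sub hct)).aestronglyMeasurable
    · filter_upwards [hle hL, self_mem_nhdsWithin] with s hs hst
      refine Eventually.of_forall fun x => ?_
      have h2 : 0 < |s - t| := abs_pos.2 (sub_ne_zero.2 hst.2)
      rw [Real.norm_eq_abs, abs_mul, abs_inv, inv_mul_le_iff₀ h2, mul_comm]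
      exact hs x
    · have := hasDerivWithinAt_iff_tendsto_slope.1 (hd x)
      exact this
  refine h1.congr' ?_
  filter_upwards [hle hc] with s hs
  rw [integral_const_mul, integral_sub (integrable_of_continuous hs) (integrable_of_continuous hct)]
  rfl

/-- The derivative of the integral of `W γ^β v` along curves `γ`, `v`. -/
lemma hasDerivWithinAt_integral_rpow_mul (ht : t ∈ J) {W : M → ℝ} (hW : Continuous W)
    (β : ℝ) {γ v : ℝ → M → ℝ} {w a : M → ℝ} (hγ : UniformLipschitzAt γ J t)
    (hv : UniformLipschitzAt v J t) (hγc : ∀ s ∈ J, Continuous (γ s))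
    (hvc : ∀ s ∈ J, Continuous (v s)) (hpos : ∀ x, 0 < γ t x)
    (hγd : ∀ x, HasDerivWithinAt (fun s => γ s x) (w x) J t)
    (hvd : ∀ x, HasDerivWithinAt (fun s => v s x) (a x) J t) :
    HasDerivWithinAt (fun s => ∫ x, W x * (γ s x ^ β * v s x) ∂lam)
      (∫ x, W x * (β * γ t x ^ (β - 1) * w x * v t x + γ t x ^ β * a x) ∂lam) J t := by
  obtain ⟨m, B, hm, hmB⟩ := exists_mem_Icc_of_continuous_pos (hγc t ht) hpos
  have hpow : Continuous fun x => γ t x ^ β :=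
    (hγc t ht).rpow_const fun x => Or.inl (hpos x).ne'
  obtain ⟨A₁, -, hA₁⟩ := exists_bound_of_continuous hpow
  obtain ⟨A₂, -, hA₂⟩ := exists_bound_of_continuous (hvc t ht)
  obtain ⟨A₃, -, hA₃⟩ := exists_bound_of_continuous hW
  obtain ⟨A₄, -, hA₄⟩ := exists_bound_of_continuous (hpow.mul (hvc t ht))
  refine hasDerivWithinAt_integral_of_uniformLipschitzAt ht
    ((uniformLipschitzAt_const W).mul ((hγ.rpow β hm hmB).mul hv hA₁ hA₂) hA₃ hA₄) ?_ fun x => ?_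
  · filter_upwards [self_mem_nhdsWithin, hγ.eventually_mem_Icc hm hmB] with s hs h1
    exact hW.mul (((hγc s hs).rpow_const fun x =>
      Or.inl (by linarith [(h1 x).1] : 0 < γ s x).ne').mul (hvc s hs))
  · refine ((((hγd x).rpow_const (p := β) (Or.inl (hpos x).ne')).mul (hvd x)).const_mul
      (W x)).congr_deriv ?_
    ring

/-- The case of a straight line `f + s b` and `v = 1`; it serves for both derivatives of the
divergence. -/
lemma hasDerivAt_integral_rpow_add_mul {W f b : M → ℝ} (hW : Continuous W) (hf : Continuous f)
    (hb : Continuous b) (hpos : ∀ x, 0 < f x) (β : ℝ) :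
    HasDerivAt (fun s : ℝ => ∫ x, W x * (f x + s * b x) ^ β ∂lam)
      (β * ∫ x, W x * (f x ^ (β - 1) * b x) ∂lam) 0 := by
  have h := hasDerivWithinAt_integral_rpow_mul (lam := lam) (t := 0) (mem_univ 0) hW β
    (γ := fun s x => f x + s * b x) (v := fun _ _ => 1) (w := b) (a := fun _ => 0)
    (uniformLipschitzAt_add_mul hb) (uniformLipschitzAt_const _)
    (fun s _ => hf.add (continuous_const.mul hb)) (fun _ _ => continuous_const)
    (by simpa using hpos) (fun x => ?_) (fun x => hasDerivWithinAt_const _ _ _)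
  · rw [hasDerivWithinAt_univ] at h
    simp only [mul_one, zero_mul, add_zero, mul_zero] at h
    refine h.congr_deriv ?_
    rw [← integral_const_mul]
    congr 1 with x
    ring
  · have := (((hasDerivAt_id (0 : ℝ)).mul_const (b x)).const_add (f x)).hasDerivWithinAt
      (s := univ)
    simpa only [id, one_mul] using this

end IntegralDerivative

/-! ### Mixed second derivative of the `α`-divergence -/

section Connection

variable {M : Type u} [TopologicalSpace M] [CompactSpace M] [MeasurableSpace M] [BorelSpace M]
  {lam : Measure M} [IsFiniteMeasure lam] {α : ℝ}

lemma hasDerivAt_divergence_right (hα : α ∈ Ioo (-1 : ℝ) 1) {μ ν c : M → ℝ} (hμ : Continuous μ)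
    (hμ0 : ∀ x, 0 < μ x) (hν : Continuous ν) (hν0 : ∀ x, 0 < ν x) (hc : Continuous c) :
    HasDerivAt (fun r : ℝ => divergence lam α μ (fun x => ν x + r * c x))
      (pExp α * (∫ x, c x ∂lam) -
        pExp α * ∫ x, ν x ^ (1 / pStar α - 1) * c x * μ x ^ (1 / pExp α) ∂lam) 0 := by
  have hps : pStar α ≠ 0 := by
    have := hα.1
    exact (div_pos two_pos (by linarith)).ne'
  have hμp : Continuous fun x => μ x ^ (1 / pExp α) := hμ.rpow_const fun x => Or.inl (hμ0 x).ne'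
  have h1 := hasDerivAt_integral_rpow_add_mul (lam := lam) hμp hν hc hν0 (1 / pStar α)
  have h2 : HasDerivAt (fun r : ℝ => ∫ x, (ν x + r * c x) ∂lam) (∫ x, c x ∂lam) 0 := by
    have e : (fun r : ℝ => ∫ x, (ν x + r * c x) ∂lam) =
        fun r => (∫ x, ν x ∂lam) + r * ∫ x, c x ∂lam := by
      ext r
      rw [← integral_const_mul]
      exact integral_add (integrable_of_continuous hν)
        (integrable_of_continuous (continuous_const.mul hc))
    rw [e]
    simpa using ((hasDerivAt_id (0 : ℝ)).mul_const (∫ x, c x ∂lam)).const_add (∫ x, ν x ∂lam)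
  have h3 := ((h2.const_mul (pExp α)).add_const (pStar α * ∫ x, μ x ∂lam)).sub
    (h1.const_mul (pStar α * pExp α))
  refine h3.congr_deriv ?_
  have e2 : ∫ x, μ x ^ (1 / pExp α) * (ν x ^ (1 / pStar α - 1) * c x) ∂lam =
      ∫ x, ν x ^ (1 / pStar α - 1) * c x * μ x ^ (1 / pExp α) ∂lam := by
    congr 1 with x
    ring
  rw [e2]
  field_simp

/-- The mixed second derivative of the `α`-divergence. -/
lemma mixedDeriv_eq (hα : α ∈ Ioo (-1 : ℝ) 1) {μ ν b c : M → ℝ} (hμ : Continuous μ)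
    (hμ0 : ∀ x, 0 < μ x) (hν : Continuous ν) (hν0 : ∀ x, 0 < ν x) (hb : Continuous b)
    (hc : Continuous c) :
    mixedDeriv lam α μ ν b c =
      -∫ x, ν x ^ (1 / pStar α - 1) * c x * (μ x ^ (1 / pExp α - 1) * b x) ∂lam := by
  have hp := pExp_pos hα
  have hW : Continuous fun x => ν x ^ (1 / pStar α - 1) * c x :=
    (hν.rpow_const fun x => Or.inl (hν0 x).ne').mul hc
  have h1 := ((hasDerivAt_integral_rpow_add_mul (lam := lam) hW hμ hb hμ0
    (1 / pExp α)).const_mul (pExp α)).const_sub (pExp α * ∫ x, c x ∂lam)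
  obtain ⟨m, B, hm, hmB⟩ := exists_mem_Icc_of_continuous_pos hμ hμ0
  have hev := (uniformLipschitzAt_add_mul (f := μ) (t := 0) hb).eventually_mem_Icc hm
    (by simpa using hmB)
  rw [nhdsWithin_univ] at hev
  -- The formula for the inner derivative needs `μ + s b > 0`, so it holds only near `s = 0`, which
  -- suffices for the outer derivative.
  have h2 : (fun s : ℝ => deriv (fun r : ℝ =>
      divergence lam α (fun x => μ x + s * b x) (fun x => ν x + r * c x)) 0) =ᶠ[𝓝 0]
      fun s => pExp α * (∫ x, c x ∂lam) - pExp α *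
        ∫ x, ν x ^ (1 / pStar α - 1) * c x * (μ x + s * b x) ^ (1 / pExp α) ∂lam := by
    filter_upwards [hev] with s hs
    exact (hasDerivAt_divergence_right hα (μ := fun x => μ x + s * b x)
      (hμ.add (continuous_const.mul hb)) (fun x => by linarith [(hs x).1]) hν hν0 hc).deriv
  unfold mixedDeriv
  rw [h2.deriv_eq, h1.deriv]
  field_simp

end Connection

/-! ### The geodesic equation -/

section Geodesics

variable {n : ℕ} {M : Type u} [TopologicalSpace M] [ChartedSpace (EuclideanSpace ℝ (Fin n)) M]
  [IsManifold (𝓡 n) ∞ M] [CompactSpace M]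

/-- Convergence in `C^∞(M)` implies uniform convergence. -/
lemma uniformLipschitzAt_of_hasTimeDeriv {γ : ℝ → M → ℝ} {w : M → ℝ} {J : Set ℝ} {t : ℝ}
    (h : (smoothSpace n M).HasTimeDeriv γ w J t) (hw : Continuous w) :
    UniformLipschitzAt γ J t := by
  choose c hc hc1 using ChartCutoff.exists_eq_one (n := n) (M := M)
  have hnhds : ∀ x : M, {y | y ∈ (c x).chart.source ∧ (c x).cutoff ((c x).chart y) = 1} ∈ 𝓝 x :=
    fun x => Filter.inter_mem ((c x).chart.open_source.mem_nhds (hc x))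
      (((c x).chart.continuousAt (hc x)).eventually (hc1 x))
  -- Finitely many charts whose cut-offs equal one on a cover of `M`: their seminorms of order zero
  -- control the sup norm.
  obtain ⟨S, -, hS⟩ := isCompact_univ.elim_nhds_subcover _ fun x _ => hnhds x
  obtain ⟨B, hB0, hB⟩ := exists_bound_of_continuous hw
  have hev : ∀ᶠ s in 𝓝[J \ {t}] t, ∀ x ∈ S, (smoothSpace n M).seminorm (c x, 0)
      (fun y => (s - t)⁻¹ * (γ s y - γ t y) - w y) ≤ 1 :=
    (Finset.eventually_all S).2 fun x _ => (h (c x, 0)).eventually (eventually_le_nhds one_pos)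
  refine ⟨1 + B, by positivity, ?_⟩
  rw [eventually_nhdsWithin_iff] at hev ⊢
  filter_upwards [hev] with s hs hsJ x
  by_cases hst : s = t
  · simp [hst]
  have h1 := hs ⟨hsJ, hst⟩
  obtain ⟨z, hz, hxz, hx1⟩ := mem_iUnion₂.1 (hS (mem_univ x))
  have h2 := (le_iSup (fun y => ‖iteratedFDeriv ℝ 0
    (localize (c z) (fun y => (s - t)⁻¹ * (γ s y - γ t y) - w y)) y‖ₑ)
    ((c z).chart x)).trans (h1 z hz)
  have h3 : ‖(s - t)⁻¹ * (γ s x - γ t x) - w x‖ ≤ 1 := by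
    have e : ‖iteratedFDeriv ℝ 0 (localize (c z) (fun y => (s - t)⁻¹ * (γ s y - γ t y) - w y))
        ((c z).chart x)‖ₑ = ‖(s - t)⁻¹ * (γ s x - γ t x) - w x‖ₑ := by
      rw [enorm_eq_iff_norm_eq, norm_iteratedFDeriv_zero, localize_apply_eq _ _ hxz hx1]
    rw [e] at h2
    rw [← ofReal_norm, ENNReal.ofReal_le_one] at h2
    exact h2
  have hst' : s - t ≠ 0 := sub_ne_zero.2 hst
  have e : γ s x - γ t x = ((s - t)⁻¹ * (γ s x - γ t x) - w x + w x) * (s - t) := by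
    field_simp
    ring
  rw [e, abs_mul]
  refine mul_le_mul_of_nonneg_right ((abs_add_le _ _).trans ?_) (abs_nonneg _)
  exact add_le_add h3 (hB x)

variable [MeasurableSpace M] [BorelSpace M] {lam : Measure M} {α : ℝ}

/-- The derivative that defines the covariant derivative of the velocity. -/
lemma hasDerivWithinAt_neg_mixedDeriv [IsFiniteMeasure lam] (hα : α ∈ Ioo (-1 : ℝ) 1) {J : Set ℝ}
    {γ v a : ℝ → M → ℝ} (h : (smoothSpace n M).IsDensityPath J γ v a) {t : ℝ} (ht : t ∈ J)
    {c : M → ℝ} (hc : Continuous c) :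
    HasDerivWithinAt (fun s => -mixedDeriv lam α (γ s) (γ t) (v s) c)
      (∫ x, c x * (a t x - geodesicAcc α (γ t) (v t) x) / γ t x ∂lam) J t := by
  have hX := isAdmissible_smoothSpace (n := n) (M := M)
  have hγc : ∀ s ∈ J, Continuous (γ s) := fun s hs => hX.continuous (h s hs).1.1
  have hvc : ∀ s ∈ J, Continuous (v s) := fun s hs => hX.continuous (h s hs).2.1
  have hac : Continuous (a t) := hX.continuous (h t ht).2.2.1
  have hpos : ∀ s ∈ J, ∀ x, 0 < γ s x := fun s hs => (h s hs).1.2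
  have hW : Continuous fun x => γ t x ^ (1 / pStar α - 1) * c x :=
    ((hγc t ht).rpow_const fun x => Or.inl (hpos t ht x).ne').mul hc
  have h1 := hasDerivWithinAt_integral_rpow_mul (lam := lam) ht hW (1 / pExp α - 1)
    (uniformLipschitzAt_of_hasTimeDeriv (h t ht).2.2.2.1 (hvc t ht))
    (uniformLipschitzAt_of_hasTimeDeriv (h t ht).2.2.2.2 hac) hγc hvc (hpos t ht)
    (fun x => (h t ht).2.2.2.1.hasDerivWithinAt hX hγc ht (hvc t ht) x)
    (fun x => (h t ht).2.2.2.2.hasDerivWithinAt hX hvc ht hac x)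
  have e1 : ∀ s ∈ J, -mixedDeriv lam α (γ s) (γ t) (v s) c =
      ∫ x, γ t x ^ (1 / pStar α - 1) * c x * (γ s x ^ (1 / pExp α - 1) * v s x) ∂lam :=
    fun s hs => by
      rw [mixedDeriv_eq hα (hγc s hs) (hpos s hs) (hγc t ht) (hpos t ht) (hvc s hs) hc, neg_neg]
  refine (h1.congr e1 (e1 t ht)).congr_deriv ?_
  congr 1 with x
  have h0 := hpos t ht x
  -- At `ν = μ` the two powers cancel by conjugacy, leaving the Fisher-Rao pairing of `c` with the
  -- defect of the geodesic equation.
  have e2 : γ t x ^ (1 / pStar α - 1) = (γ t x ^ (1 / pExp α))⁻¹ := by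
    rw [one_div_pStar, sub_sub_cancel_left, Real.rpow_neg h0.le]
  have e3 : 0 < γ t x ^ (1 / pExp α) := Real.rpow_pos_of_pos h0 _
  rw [geodesicAcc, e2, one_div_pStar, Real.rpow_sub_one h0.ne' (1 / pExp α - 1),
    Real.rpow_sub_one h0.ne' (1 / pExp α)]
  generalize γ t x ^ (1 / pExp α) = y at e3
  generalize 1 / pExp α = r
  field_simp
  ring

/-- The geodesic equation of the `α`-connection. -/
lemma isAlphaGeodesic_iff (hlam : IsSmoothVolume n lam) (hα : α ∈ Ioo (-1 : ℝ) 1) {J : Set ℝ}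
    (hJ : J.OrdConnected) (hJn : J.Nontrivial) {γ v a : ℝ → M → ℝ}
    (h : (smoothSpace n M).IsDensityPath J γ v a) :
    IsAlphaGeodesic n lam α J γ v ↔ ∀ t ∈ J, a t = geodesicAcc α (γ t) (v t) := by
  have hX := isAdmissible_smoothSpace (n := n) (M := M)
  have := hlam.isLocallyFiniteMeasure
  have := hlam.isOpenPosMeasure
  have : IsFiniteMeasure lam := ⟨isCompact_univ.measure_lt_top⟩
  have hzero : ∀ t c, fisherRao lam (γ t) (fun _ => 0) c = 0 := fun t c => by simp [fisherRao]
  -- An interval with more than one point has nonempty interior, so one-sided derivatives at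
  -- endpoints are unique too.
  have hUD : UniqueDiffOn ℝ J := by
    obtain ⟨x, hx, y, hy, hxy⟩ := hJn.exists_lt
    refine uniqueDiffOn_convex hJ.convex ?_
    exact (nonempty_Ioo.2 hxy).mono
      (interior_maximal (Ioo_subset_Icc_self.trans (hJ.out hx hy)) isOpen_Ioo)
  refine ⟨fun hgeo t ht => ?_, fun heq t ht c hc => ?_⟩
  · set d : M → ℝ := fun x => a t x - geodesicAcc α (γ t) (v t) x with hd
    have hpos := (h t ht).1.2
    have hdm : (smoothSpace n M).Mem d := by
      have h1 := hX.add_mem (h t ht).2.2.1 (hX.mul_mem (hX.const_mem (-(1 / pStar α)))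
        (hX.mul_mem (hX.mul_mem (h t ht).2.1 (h t ht).2.1)
          (hX.rpow_mem (-1) (h t ht).1.1 hpos)))
      convert! h1 using 2
      simp only [hd, geodesicAcc, Real.rpow_neg_one]
      ring
    have hdc := hX.continuous hdm
    -- The defect `d` is smooth, hence an admissible tangent vector; tested against itself it gives
    -- the integrand `d² / γ`.
    have h1 := hgeo t ht d hdm
    have h2 := hasDerivWithinAt_neg_mixedDeriv (lam := lam) hα h ht hdc
    have h3 := (hUD t ht).eq_deriv J h2 h1
    rw [hzero] at h3
    have hnn : ∀ x, 0 ≤ d x * (a t x - geodesicAcc α (γ t) (v t) x) / γ t x := fun x =>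
      div_nonneg (mul_self_nonneg (d x)) (hpos x).le
    have hcont : Continuous fun x => d x * (a t x - geodesicAcc α (γ t) (v t) x) / γ t x :=
      (hdc.mul hdc).div (hX.continuous (h t ht).1.1) fun x => (hpos x).ne'
    have h4 := (integral_eq_zero_iff_of_nonneg hnn (integrable_of_continuous hcont)).1 h3
    have h5 := (hcont.ae_eq_iff_eq lam continuous_const).1 h4
    ext x
    have h6 : d x * d x / γ t x = 0 := congrFun h5 x
    rw [div_eq_zero_iff, or_iff_left (hpos x).ne', mul_self_eq_zero] at h6
    exact sub_eq_zero.1 h6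
  · rw [hzero]
    refine (hasDerivWithinAt_neg_mixedDeriv (lam := lam) hα h ht
      (hX.continuous hc)).congr_deriv ?_
    simp [heq t ht]

end Geodesics

end AlphaGeodesic

end

open AlphaGeodesic in
theorem theorem3p2 (n : ℕ) {M : Type u} [TopologicalSpace M]
    [ChartedSpace (EuclideanSpace ℝ (Fin n)) M] [IsManifold (𝓡 n) ∞ M]
    [CompactSpace M] [T2Space M] [MeasurableSpace M] [BorelSpace M]
    (lam : Measure M) (hlam : IsSmoothVolume n lam) (α : ℝ) (hα : α ∈ Ioo (-1 : ℝ) 1) :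
    -- the geodesic equation of the `α`-connection on `Dens_+(M)`
    (∀ J : Set ℝ, J.OrdConnected → J.Nontrivial → ∀ γ v a : ℝ → M → ℝ,
      (smoothSpace n M).IsDensityPath J γ v a →
      (IsAlphaGeodesic n lam α J γ v ↔ ∀ t ∈ J, a t = geodesicAcc α (γ t) (v t))) ∧
    -- local well-posedness, with one and the same maximal solution for all orders `k` and for
    -- smooth densities
    (∀ μ₀ v₀ : M → ℝ, ∃ (T : ℝ≥0∞) (γ : ℝ → M → ℝ), 0 < T ∧
      (∀ k : ℝ, (n : ℝ) / 2 < k →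
        (sobolevSpace n M k).IsDensity μ₀ → (sobolevSpace n M k).Mem v₀ →
        (sobolevSpace n M k).IsMaximalSolution α μ₀ v₀ T γ) ∧
      ((smoothSpace n M).IsDensity μ₀ → (smoothSpace n M).Mem v₀ →
        (smoothSpace n M).IsMaximalSolution α μ₀ v₀ T γ)) := by
  refine ⟨fun J hJ hJn γ v a h => isAlphaGeodesic_iff hlam hα hJ hJn h, fun μ₀ v₀ => ?_⟩
  obtain ⟨T, γ, hT, h⟩ := exists_maximalSolution hα μ₀ v₀
  exact ⟨T, γ, hT, fun k hk => h _ (isAdmissible_sobolevSpace hk), h _ isAdmissible_smoothSpace⟩
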